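/- All logarithms in $D_{\mathrm{KL}}$, $H$, $I$ are to base $2$. Let $P$ be a Borel probability measure on a Polish space $S$, and let $\Pi=\{(T_n,X_n)\}_{n\ge 1}$, with $T_1<T_2<\cdots$, be a $(1,P)$-Poisson process, i.e. a Poisson point process on $(0,\infty)\times S$ with mean measure $\mathrm{Lebesgue}\times P$, listed in time order. For a probability measure $Q\ll P$ with density ratio $r=dQ/dP:S\to[0,\infty)$, put $$\sigma(h)=\int_0^h\frac{d\eta}{w_Q(\eta)-\eta\,w_P(\eta)}\in[0,\infty],\qquad w_P(\eta)=P(r\ge\eta),\quad w_Q(\eta)=Q(r\ge\eta)$$ (with $1/0=\infty$). Greedy Poisson rejection sampling (GPRS) with proposal $P$ and target $Q$ returns $X_N$, where $N\ge1$ is the smallest index $n$ with $T_n<\sigma(r(X_n))$. Theorem [Expected Codelength]. (1) For all $P$, $Q\ll P$ and $\Pi$ as above, GPRS terminates almost surely, $X_N\sim Q$, and $$\mathbb E[\log_2 N]\le D_{\mathrm{KL}}(Q\|P)+2\log_2 e .$$ (2) Let $P_{\mathbf x,\mathbf y}$ be a joint distribution of a random variable $\mathbf x$ in a Polish space and a random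 variable $\mathbf y$ in a measurable space, such that $P_{\mathbf x\mid\mathbf y=y}\ll P_{\mathbf x}$ for $P_{\mathbf y}$-almost every $y$, with density ratios $dP_{\mathbf x\mid\mathbf y=y}/dP_{\mathbf x}$ chosen jointly measurable in $(x,y)$. Let the shared randomness $\Pi$ be a $(1,P_{\mathbf x})$-Poisson process, independent of the input $\mathbf y\sim P_{\mathbf y}$. The sender runs GPRS on $\Pi$ with proposal $P_{\mathbf x}$ and target $P_{\mathbf x\mid\mathbf y}$ and encodes the index $N$ of the accepted arrival; the receiver outputs $\mathbf x=X_N$. Then the sampler terminates almost surely, $(\mathbf x,\mathbf y)\sim P_{\mathbf x,\mathbf y}$ (so this is a channel simulation protocol), and $$H[\mathbf x\mid\Pi]\le I[\mathbf x;\mathbf y]+\log_2\bigl(I[\mathbf x;\mathbf y]+1\bigr)+6,$$ where $I[\mathbf x;\mathbf y]=D_{\mathrm{KL}}(P_{\mathbf x,\mathbf y}\|P_{\mathbf x}\times P_{\mathbf y})\in[0,\infty]$ (the bound is void if it is infinite), and $H[\mathbf x\mid\Pi]$ is the expectation over $\Pi$ of the Shannon entropy of the conditional law of $\mathbf x$ given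 $\Pi$ (taken to be $\infty$ where that law is not discrete). -/

import Mathlib

open MeasureTheory ProbabilityTheory
open scoped NNReal ENNReal

noncomputable section

namespace GPRS

variable {S : Type*} [MeasurableSpace S]

/-! ### Poisson processes, listed in time order -/

/-- The number of points of the configuration `p = ((T₁, X₁), (T₂, X₂), …)` that lie in `A`.
Arrivals are stored with indices starting from `0`: `p n` is the `(n + 1)`-st arrival. -/
def count (p : ℕ → ℝ × S) (A : Set (ℝ × S)) : ℕ∞ := {n | p n ∈ A}.encard

/-- The mean measure `c • (Lebesgue measure on (0, ∞)) × P` of a `(c, P)`-Poisson process. -/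
def meanMeasure (c : ℝ≥0) (P : Measure S) : Measure (ℝ × S) :=
  c • ((volume.restrict (Set.Ioi (0 : ℝ))).prod P)

/-- `proc : Ω → (ℕ → ℝ × S)` is the time-ordered list of arrivals of a `(c, P)`-Poisson process:
the arrival times are almost surely strictly increasing, the number of points in a set of finite
mean measure is Poisson distributed with that mean, and the numbers of points in disjoint sets
are mutually independent. -/
structure IsPoissonProcess {Ω : Type*} [MeasurableSpace Ω] (c : ℝ≥0) (P : Measure S)
    (Pr : Measure Ω) (proc : Ω → ℕ → ℝ × S) : Prop where
  measurable : Measurable proc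
  strictMono : ∀ᵐ ω ∂Pr, StrictMono fun n => (proc ω n).1
  poisson : ∀ A : Set (ℝ × S), MeasurableSet A → meanMeasure c P A ≠ ∞ →
    Pr.map (fun ω => count (proc ω) A) =
      (poissonMeasure (meanMeasure c P A).toNNReal).map (Nat.cast : ℕ → ℕ∞)
  indep : ∀ A : ℕ → Set (ℝ × S), (∀ i, MeasurableSet (A i)) →
    Pairwise (fun i j => Disjoint (A i) (A j)) → iIndepFun (fun i ω => count (proc ω) (A i)) Pr

/-! ### Greedy Poisson rejection sampling -/

/-- The stretch function `σ(h) = ∫₀ʰ dη / (w_Q(η) - η w_P(η))`, where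
`w_P(η) = P(r ≥ η)` and `w_Q(η) = Q(r ≥ η)`. It takes the value `∞` where the integral
diverges, in particular for `h` at or above the `P`-essential supremum of `r = dQ/dP`. -/
def stretch (P Q : Measure S) (r : S → ℝ≥0) (h : ℝ≥0) : ℝ≥0∞ :=
  ∫⁻ η in Set.Ioc (0 : ℝ) h,
    (ENNReal.ofReal (Q.real {x | η ≤ (r x : ℝ)} - η * P.real {x | η ≤ (r x : ℝ)}))⁻¹

/-- The sampler accepts the arrival `(t, x)` if `t < σ(r(x))`. -/
def Accepts (P Q : Measure S) (r : S → ℝ≥0) (a : ℝ × S) : Prop :=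
  ENNReal.ofReal a.1 < stretch P Q r (r a.2)

/-- The index `N ∈ {1, 2, …}` of the first accepted arrival (with value `1` if no arrival is
accepted). -/
def index (P Q : Measure S) (r : S → ℝ≥0) (p : ℕ → ℝ × S) : ℕ :=
  sInf {n | Accepts P Q r (p n)} + 1

/-- The receiver's output: the spatial coordinate of the `N`-th arrival. -/
def decode (p : ℕ → ℝ × S) (N : ℕ) : S := (p (N - 1)).2

/-! ### Information measures, in bits -/

/-- Relative entropy `D_KL(Q‖P)` in bits. -/
def klBits {α : Type*} [MeasurableSpace α] (Q P : Measure α) : ℝ≥0∞ :=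
  InformationTheory.klDiv Q P / ENNReal.ofReal (Real.log 2)

open Classical in
/-- Entropy in bits of a probability measure: Shannon's `∑ₓ -μ{x} log₂ μ{x}` if `μ` is discrete
(carried by a countable set), and `∞` otherwise. -/
def entropyBits (μ : Measure S) : ℝ≥0∞ :=
  if ∃ s : Set S, s.Countable ∧ μ sᶜ = 0 then
    ∑' x, ENNReal.ofReal (Real.negMulLog (μ.real {x}) / Real.log 2)
  else ∞

/-- The conditional entropy `H[x | z]` in bits: the mean entropy of the regular conditional
distribution of `x` given `z`. -/
def condEntropyBits {Ω Z : Type*} [MeasurableSpace Ω] [MeasurableSpace Z]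
    [StandardBorelSpace S] [Nonempty S] (Pr : Measure Ω) [IsFiniteMeasure Pr]
    (x : Ω → S) (z : Ω → Z) : ℝ≥0∞ :=
  ∫⁻ c, entropyBits (condDistrib x z Pr c) ∂(Pr.map z)

/-- Mutual information in bits of a pair with joint law `ρ`: `D_KL(ρ ‖ ρ₁ × ρ₂)`. -/
def mutualInfoBits {Y : Type*} [MeasurableSpace Y] (ρ : Measure (Y × S)) : ℝ≥0∞ :=
  klBits ρ (ρ.fst.prod ρ.snd)

end GPRS

end

/-! ### Integrated tails and the stretch function of one real variable -/

namespace GPRS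

open Set Filter Topology

/-! Write W(η) = P(r ≥ η). The layer-cake formula gives w_Q(η) − η w_P(η) = ∫ (r − η)⁺ dP = ∫_η^∞ W
=: F(η), so σ' = 1/F with F(0) = 1. Everything rests on the substitution t = σ(η), a bijection from
{η > 0 : F(η) > 0} onto (0, ∞) (`IsTail.lintegral_Ioi_eq`). The acceptance region up to time σ(η)
has mean measure ∫_0^η W/F = −log F(η), so nothing is accepted by then with probability F(η)
(`survival_realStretch`). Hence the first accepted arrival has law F(η) · dη/F(η) · P(dx) = dη P(dx)
on η ≤ r(x), and integrating η out leaves r dP = Q.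

For the index, given acceptance at time t the number of rejected arrivals is Poisson with mean at
most t, so E log N ≤ log(1 + t) by Jensen. From σ(η) ≤ η/F(η) and F ≤ 1 one gets log(1 + t) ≤ log(1
+ η) − log F(η). The first term contributes at most the divergence plus one nat, the second at most
∫_0^1 −log u du = 1 nat (`lintegral_survival_mul_log_le`).

Conditioning on the acceptance time is replaced by cutting time into cells of length δ: in each cell
three disjoint sets have independent counts, which yields upper bounds up to a factor e^δ
(`IsPoissonProcess.lintegral_firstIndex_le`). Upper bounds also determine the output law, since a
probability measure dominated by another one equals it.

For the protocol, the output given the arrivals is a function of the index, so its entropy is at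
most the mean length of any code for the index satisfying Kraft's inequality (`entropyBits_map_le`).
A power-law code has length linear in log N; its exponent is tuned to the mutual information
(`exists_powerCode_bound`). -/

/-- The tail function `W η = P (η ≤ r)` of a nonnegative variable `r` of mean one. -/
structure IsTail (W : ℝ → ℝ) : Prop where
  anti : Antitone W
  nonneg : ∀ t, 0 ≤ W t
  le_one : ∀ t, W t ≤ 1
  integrableOn : IntegrableOn W (Ioi 0)
  integral_eq : ∫ t in Ioi 0, W t = 1

/-- The integrated tail `∫_η^∞ W`. -/
noncomputable def excess (W : ℝ → ℝ) (η : ℝ) : ℝ := ∫ ζ in Ioi η, W ζ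

/-- The positive reals at which the integrated tail does not vanish. -/
def excessSupport (W : ℝ → ℝ) : Set ℝ := {η | 0 < η ∧ 0 < excess W η}

/-- The finite-valued stretch function `∫_0^η dζ / excess W ζ`. -/
noncomputable def realStretch (W : ℝ → ℝ) (η : ℝ) : ℝ := ∫ ζ in (0 : ℝ)..η, (excess W ζ)⁻¹

namespace IsTail

variable {W : ℝ → ℝ}

lemma intervalIntegrable (h : IsTail W) (a b : ℝ) : IntervalIntegrable W volume a b :=
  h.anti.intervalIntegrable

lemma integrableOn_Ioi (h : IsTail W) (a : ℝ) : IntegrableOn W (Ioi a) := by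
  have : Ioi a ⊆ Ioc a 0 ∪ Ioi 0 := by
    intro x hx
    rcases le_or_gt x 0 with h0 | h0
    · exact Or.inl ⟨hx, h0⟩
    · exact Or.inr h0
  refine IntegrableOn.mono_set (IntegrableOn.union ?_ h.integrableOn) this
  exact (h.intervalIntegrable a 0).1

lemma excess_eq (h : IsTail W) (a b : ℝ) : excess W b = excess W a - ∫ ζ in a..b, W ζ := by
  have := intervalIntegral.integral_Ioi_sub_Ioi' (h.integrableOn_Ioi a) (h.integrableOn_Ioi b)
  unfold excess
  linarith

lemma excess_zero (h : IsTail W) : excess W 0 = 1 := h.integral_eq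

lemma continuous_excess (h : IsTail W) : Continuous (excess W) := by
  have : excess W = fun b => excess W 0 - ∫ ζ in (0 : ℝ)..b, W ζ := by
    ext b; exact h.excess_eq 0 b
  rw [this]
  exact continuous_const.sub (intervalIntegral.continuous_primitive h.intervalIntegrable 0)

lemma excess_nonneg (h : IsTail W) (η : ℝ) : 0 ≤ excess W η :=
  integral_nonneg fun _ => h.nonneg _

lemma excess_antitone (h : IsTail W) : Antitone (excess W) := by
  intro a b hab
  rw [h.excess_eq a b]
  have := intervalIntegral.integral_nonneg (μ := volume) hab (f := W) fun u _ => h.nonneg u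
  linarith

lemma excess_le_one (h : IsTail W) {η : ℝ} (hη : 0 ≤ η) : excess W η ≤ 1 :=
  h.excess_zero ▸ h.excess_antitone hη

lemma tendsto_excess (h : IsTail W) : Tendsto (excess W) atTop (𝓝 0) := by
  have h1 := intervalIntegral_tendsto_integral_Ioi 0 h.integrableOn tendsto_id
  have : excess W = fun b => excess W 0 - ∫ ζ in (0 : ℝ)..b, W ζ := by
    ext b; exact h.excess_eq 0 b
  rw [this, h.excess_zero]
  simpa [h.integral_eq] using h1.const_sub 1

lemma exists_excess_lt (h : IsTail W) {ε : ℝ} (hε : 0 < ε) :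
    ∃ η ∈ excessSupport W, excess W η < ε := by
  obtain ⟨b, hb, hb0⟩ := ((h.tendsto_excess.eventually_lt_const
    (show 0 < min ε 1 by positivity)).and (eventually_ge_atTop 0)).exists
  have hpos : 0 < min ε 1 := by positivity
  -- The level is positive even if `excess W b = 0`, as happens for bounded ratios. It is below 1 =
  -- `excess W 0`, which keeps c away from 0.
  obtain ⟨c, hc, hce⟩ := intermediate_value_Icc' hb0 h.continuous_excess.continuousOn
    (show max (excess W b) (min ε 1 / 2) ∈ Icc (excess W b) (excess W 0) from
      ⟨le_max_left _ _, max_le (h.excess_antitone hb0) (by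
        rw [h.excess_zero]; linarith [min_le_right ε 1])⟩)
  have h3 : max (excess W b) (min ε 1 / 2) < min ε 1 := max_lt hb (by linarith)
  refine ⟨c, ⟨lt_of_le_of_ne hc.1 ?_, ?_⟩, ?_⟩
  · rintro rfl
    rw [h.excess_zero] at hce
    linarith [min_le_right ε 1]
  · rw [hce]; exact lt_max_of_lt_right (by linarith)
  · rw [hce]; exact h3.trans_le (min_le_left _ _)

lemma excess_pos_of_mem (h : IsTail W) {η ζ : ℝ} (hη : η ∈ excessSupport W) (hζ : ζ ≤ η) :
    0 < excess W ζ := hη.2.trans_le (h.excess_antitone hζ)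

lemma isOpen_excessSupport (h : IsTail W) : IsOpen (excessSupport W) :=
  (isOpen_lt continuous_const continuous_id).inter
    (isOpen_lt continuous_const h.continuous_excess)

lemma measurableSet_excessSupport (h : IsTail W) : MeasurableSet (excessSupport W) :=
  h.isOpen_excessSupport.measurableSet

lemma continuousOn_inv (h : IsTail W) {η : ℝ} (hη : η ∈ excessSupport W) :
    ContinuousOn (fun ζ => (excess W ζ)⁻¹) (Iic η) :=
  h.continuous_excess.continuousOn.inv₀ fun _ hζ => (h.excess_pos_of_mem hη hζ).ne'

lemma intervalIntegrable_inv (h : IsTail W) {η a : ℝ} (hη : η ∈ excessSupport W) (ha : a ≤ η) :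
    IntervalIntegrable (fun ζ => (excess W ζ)⁻¹) volume a η :=
  ((h.continuousOn_inv hη).mono (by
    rw [uIcc_of_le ha]; exact Icc_subset_Iic_self)).intervalIntegrable

lemma hasDerivAt_realStretch (h : IsTail W) {η : ℝ} (hη : η ∈ excessSupport W) :
    HasDerivAt (realStretch W) (excess W η)⁻¹ η := by
  refine intervalIntegral.integral_hasDerivAt_right (h.intervalIntegrable_inv hη hη.1.le) ?_ ?_
  · exact (h.continuous_excess.measurable.inv).stronglyMeasurable.stronglyMeasurableAtFilter
  · exact h.continuous_excess.continuousAt.inv₀ hη.2.ne'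

lemma mem_of_mem_of_le (h : IsTail W) {η ζ : ℝ} (hη : η ∈ excessSupport W) (h0 : 0 < ζ)
    (hζ : ζ ≤ η) : ζ ∈ excessSupport W := ⟨h0, h.excess_pos_of_mem hη hζ⟩

/-- On [0, η] the excess lies in (0, 1], so the integrand is at least 1. -/
lemma realStretch_sub (h : IsTail W) {η ζ : ℝ} (hη : η ∈ excessSupport W) (h0 : 0 ≤ ζ)
    (hζ : ζ ≤ η) : η - ζ ≤ realStretch W η - realStretch W ζ := by
  have h2 : IntervalIntegrable (fun ζ => (excess W ζ)⁻¹) volume 0 ζ :=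
    (h.intervalIntegrable_inv hη hη.1.le).mono_set (by
      rw [uIcc_of_le h0, uIcc_of_le hη.1.le]; exact Icc_subset_Icc_right hζ)
  unfold realStretch
  rw [intervalIntegral.integral_interval_sub_left (h.intervalIntegrable_inv hη hη.1.le) h2]
  have h1 : ∫ _ in ζ..η, (1 : ℝ) = η - ζ := by simp
  rw [← h1]
  refine intervalIntegral.integral_mono_on hζ (by simp) (h.intervalIntegrable_inv hη hζ) ?_
  intro x hx
  exact (one_le_inv₀ (h.excess_pos_of_mem hη hx.2)).2 (h.excess_le_one (h0.trans hx.1))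

lemma strictMonoOn_realStretch (h : IsTail W) : StrictMonoOn (realStretch W) (excessSupport W) := by
  intro a ha b hb hab
  have := h.realStretch_sub hb ha.1.le hab.le
  linarith

lemma realStretch_pos (h : IsTail W) {η : ℝ} (hη : η ∈ excessSupport W) : 0 < realStretch W η := by
  have := h.realStretch_sub hη le_rfl hη.1.le
  have h0 : realStretch W 0 = 0 := by simp [realStretch]
  linarith [hη.1]

lemma realStretch_le (h : IsTail W) {η : ℝ} (hη : η ∈ excessSupport W) :
    realStretch W η ≤ η / excess W η := by
  have h1 : ∫ _ in (0 : ℝ)..η, (excess W η)⁻¹ = η / excess W η := by simp [div_eq_mul_inv]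
  rw [← h1]
  refine intervalIntegral.integral_mono_on hη.1.le (h.intervalIntegrable_inv hη hη.1.le)
    (by simp) ?_
  intro x hx
  exact inv_anti₀ hη.2 (h.excess_antitone hx.2)

lemma intervalIntegrable_div (h : IsTail W) {η : ℝ} (hη : η ∈ excessSupport W) :
    IntervalIntegrable (fun ζ => W ζ / excess W ζ) volume 0 η := by
  simp only [div_eq_mul_inv]
  exact (h.intervalIntegrable 0 η).mul_continuousOn ((h.continuousOn_inv hη).mono (by
    rw [uIcc_of_le hη.1.le]; exact Icc_subset_Iic_self))

/-- The excess has derivative −W wherever the monotone W is continuous, hence off a countable set,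
and it equals 1 at 0. -/
lemma integral_div_excess (h : IsTail W) {η : ℝ} (hη : η ∈ excessSupport W) :
    ∫ ζ in (0 : ℝ)..η, W ζ / excess W ζ = -Real.log (excess W η) := by
  have hd : ∀ x, ContinuousAt W x → HasDerivAt (excess W) (-W x) x := by
    intro x hx
    have : excess W = fun b => excess W 0 - ∫ ζ in (0 : ℝ)..b, W ζ := by
      ext b; exact h.excess_eq 0 b
    rw [this]
    exact (intervalIntegral.integral_hasDerivAt_right (h.intervalIntegrable 0 x)
      h.anti.measurable.stronglyMeasurable.stronglyMeasurableAtFilter hx).const_sub _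
  have := integral_eq_of_hasDerivAt_off_countable (fun x => -Real.log (excess W x))
    (fun ζ => W ζ / excess W ζ) (a := 0) (b := η) h.anti.countable_not_continuousAt ?_ ?_
    (h.intervalIntegrable_div hη)
  · rw [this, h.excess_zero]; simp
  · refine (h.continuous_excess.continuousOn.log ?_).neg
    intro x hx
    rw [uIcc_of_le hη.1.le] at hx
    exact (h.excess_pos_of_mem hη hx.2).ne'
  · intro x hx
    have hx1 : x < η := by simpa [hη.1.le] using hx.1.2
    have hc : ContinuousAt W x := by simpa using hx.2
    have := ((hd x hc).log (h.excess_pos_of_mem hη hx1.le).ne').fun_neg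
    exact this.congr_deriv (by ring)

/-- Follows from W ≤ 1. It makes the stretch unbounded as the excess tends to 0, hence onto (0, ∞).
-/
lemma neg_log_excess_le (h : IsTail W) {η : ℝ} (hη : η ∈ excessSupport W) :
    -Real.log (excess W η) ≤ realStretch W η := by
  rw [← h.integral_div_excess hη]
  refine intervalIntegral.integral_mono_on hη.1.le (h.intervalIntegrable_div hη)
    (h.intervalIntegrable_inv hη hη.1.le) ?_
  intro x hx
  rw [div_eq_mul_inv]
  exact mul_le_of_le_one_left (inv_nonneg.2 (h.excess_nonneg x)) (h.le_one x)

lemma image_realStretch (h : IsTail W) : realStretch W '' excessSupport W = Ioi 0 := by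
  apply Subset.antisymm
  · rintro _ ⟨η, hη, rfl⟩
    exact h.realStretch_pos hη
  · intro t ht
    obtain ⟨η, hη, hlt⟩ := h.exists_excess_lt (Real.exp_pos (-t))
    have h1 : t < realStretch W η := by
      have := Real.log_lt_log hη.2 hlt
      rw [Real.log_exp] at this
      linarith [h.neg_log_excess_le hη]
    have hc : ContinuousOn (realStretch W) (Icc 0 η) := by
      have := intervalIntegral.continuousOn_primitive_interval'
        (h.intervalIntegrable_inv hη hη.1.le) (a := 0) left_mem_uIcc
      rwa [uIcc_of_le hη.1.le] at this
    have h0 : realStretch W 0 = 0 := by simp [realStretch]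
    obtain ⟨c, hc, hct⟩ := intermediate_value_Icc hη.1.le hc
      (show t ∈ Icc (realStretch W 0) (realStretch W η) from ⟨by rw [h0]; exact ht.le, h1.le⟩)
    refine ⟨c, h.mem_of_mem_of_le hη (lt_of_le_of_ne hc.1 ?_) hc.2, hct⟩
    rintro rfl
    rw [h0] at hct
    exact ht.ne hct

/-- The substitution t = σ(η), from time to levels of the density ratio. Its Jacobian later cancels
the survival probability. -/
lemma lintegral_Ioi_eq (h : IsTail W) (g : ℝ → ℝ≥0∞) :
    ∫⁻ t in Ioi 0, g t =
      ∫⁻ η in excessSupport W, ENNReal.ofReal (excess W η)⁻¹ * g (realStretch W η) := by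
  rw [← h.image_realStretch, lintegral_image_eq_lintegral_abs_deriv_mul
    h.measurableSet_excessSupport
    (fun x hx => (h.hasDerivAt_realStretch hx).hasDerivWithinAt) h.strictMonoOn_realStretch.injOn]
  refine setLIntegral_congr_fun h.measurableSet_excessSupport fun x hx => ?_
  simp only [abs_of_pos (inv_pos.2 hx.2)]

lemma ofReal_excess (h : IsTail W) (η : ℝ) :
    ENNReal.ofReal (excess W η) = ∫⁻ ζ in Ioi η, ENNReal.ofReal (W ζ) :=
  ofReal_integral_eq_lintegral_ofReal (h.integrableOn_Ioi η) (ae_of_all _ h.nonneg)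

lemma ofReal_neg_log_excess (h : IsTail W) {η : ℝ} (hη : η ∈ excessSupport W) :
    ENNReal.ofReal (-Real.log (excess W η)) =
      ∫⁻ ζ in Ioc 0 η, ENNReal.ofReal (W ζ) * (ENNReal.ofReal (excess W ζ))⁻¹ := by
  rw [← h.integral_div_excess hη, intervalIntegral.integral_of_le hη.1.le,
    ofReal_integral_eq_lintegral_ofReal (h.intervalIntegrable_div hη).1
      (ae_of_all _ fun x => div_nonneg (h.nonneg x) (h.excess_nonneg x))]
  refine setLIntegral_congr_fun measurableSet_Ioc fun x hx => ?_
  rw [ENNReal.ofReal_div_of_pos (h.excess_pos_of_mem hη hx.2), div_eq_mul_inv]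

lemma ofReal_realStretch (h : IsTail W) {η : ℝ} (hη : η ∈ excessSupport W) :
    ENNReal.ofReal (realStretch W η) =
      ∫⁻ ζ in Ioc 0 η, (ENNReal.ofReal (excess W ζ))⁻¹ := by
  unfold realStretch
  rw [intervalIntegral.integral_of_le hη.1.le,
    ofReal_integral_eq_lintegral_ofReal (h.intervalIntegrable_inv hη hη.1.le).1
      (ae_of_all _ fun x => inv_nonneg.2 (h.excess_nonneg x))]
  refine setLIntegral_congr_fun measurableSet_Ioc fun x hx => ?_
  rw [ENNReal.ofReal_inv_of_pos (h.excess_pos_of_mem hη hx.2)]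

/-- Formally ∫ (−F')(−log F) = ∫_0^1 −log u du = 1. Writing −log F(η) as ∫_0^η W/F and exchanging
integrals, the inner integral is at most ∫_ζ^∞ W = F(ζ), which cancels 1/F(ζ) and leaves at most ∫ W
= 1. -/
lemma lintegral_mul_neg_log_excess_le (h : IsTail W) :
    ∫⁻ η in excessSupport W, ENNReal.ofReal (W η) * ENNReal.ofReal (-Real.log (excess W η)) ≤ 1 := by
  have hWm : Measurable fun η => ENNReal.ofReal (W η) := h.anti.measurable.ennreal_ofReal
  have hFm : Measurable fun η => (ENNReal.ofReal (excess W η))⁻¹ :=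
    h.continuous_excess.measurable.ennreal_ofReal.inv
  have hWFm : Measurable fun η => ENNReal.ofReal (W η) * (ENNReal.ofReal (excess W η))⁻¹ :=
    hWm.mul hFm
  set D := excessSupport W
  have hD : MeasurableSet D := h.measurableSet_excessSupport
  have hset : MeasurableSet {p : ℝ × ℝ | p.2 ≤ p.1} := measurableSet_le measurable_snd measurable_fst
  let G : ℝ → ℝ → ℝ≥0∞ := fun η ζ => {p : ℝ × ℝ | p.2 ≤ p.1}.indicator
    (fun p => ENNReal.ofReal (W p.1) * (ENNReal.ofReal (W p.2) *
      (ENNReal.ofReal (excess W p.2))⁻¹)) (η, ζ)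
  have hGm : Measurable (Function.uncurry G) := by
    refine Measurable.indicator ?_ hset
    exact (hWm.comp measurable_fst).mul
      ((hWm.comp measurable_snd).mul (hFm.comp measurable_snd))
  calc ∫⁻ η in D, ENNReal.ofReal (W η) * ENNReal.ofReal (-Real.log (excess W η))
      = ∫⁻ η in D, ∫⁻ ζ in D, G η ζ := by
        refine setLIntegral_congr_fun hD fun η hη => ?_
        rw [h.ofReal_neg_log_excess hη, ← lintegral_const_mul _ hWFm,
          ← lintegral_indicator measurableSet_Ioc, ← lintegral_indicator hD]
        congr 1; ext ζ
        by_cases h1 : ζ ∈ Ioc 0 η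
        · have h2 : ζ ∈ D := h.mem_of_mem_of_le hη h1.1 h1.2
          simp [G, indicator, h1.1, h1.2, h2]
        · rw [indicator_of_notMem h1]
          by_cases h2 : ζ ∈ D
          · have h3 : ¬ ζ ≤ η := fun h3 => h1 ⟨h2.1, h3⟩
            simp [G, indicator, h2, h3]
          · simp [indicator, h2]
    _ = ∫⁻ ζ in D, ∫⁻ η in D, G η ζ := lintegral_lintegral_swap hGm.aemeasurable
    _ ≤ ∫⁻ ζ in D, ENNReal.ofReal (W ζ) := by
        refine setLIntegral_mono' hD fun ζ hζ => ?_
        calc ∫⁻ η in D, G η ζ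
            ≤ ∫⁻ η, (Ici ζ).indicator (fun η => ENNReal.ofReal (W η) * (ENNReal.ofReal (W ζ) *
                (ENNReal.ofReal (excess W ζ))⁻¹)) η := setLIntegral_le_lintegral _ _
          _ = ENNReal.ofReal (excess W ζ) * (ENNReal.ofReal (W ζ) *
                (ENNReal.ofReal (excess W ζ))⁻¹) := by
              rw [lintegral_indicator measurableSet_Ici, lintegral_mul_const _ hWm,
                h.ofReal_excess, setLIntegral_congr Ioi_ae_eq_Ici]
          _ = ENNReal.ofReal (W ζ) := by
              rw [mul_left_comm, ENNReal.mul_inv_cancel (by simpa using hζ.2) ENNReal.ofReal_ne_top,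
                mul_one]
    _ ≤ ∫⁻ ζ in Ioi 0, ENNReal.ofReal (W ζ) := lintegral_mono_set fun x hx => hx.1
    _ = 1 := by
        rw [← h.ofReal_excess, h.excess_zero, ENNReal.ofReal_one]

end IsTail

end GPRS

/-! ### The tail of a density ratio and the acceptance region -/

namespace GPRS

open Set Filter Topology

/-- The stretch function as a function of the integrated tail. -/
noncomputable def stretchOf (W : ℝ → ℝ) (h : ℝ) : ℝ≥0∞ :=
  ∫⁻ ζ in Ioc 0 h, (ENNReal.ofReal (excess W ζ))⁻¹

lemma stretchOf_mono (W : ℝ → ℝ) : Monotone (stretchOf W) := fun _ _ h =>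
  lintegral_mono_set (Ioc_subset_Ioc_right h)

lemma IsTail.stretchOf_eq {W : ℝ → ℝ} (h : IsTail W) {η : ℝ} (hη : η ∈ excessSupport W) :
    stretchOf W η = ENNReal.ofReal (realStretch W η) := (h.ofReal_realStretch hη).symm

variable {S : Type*} [MeasurableSpace S]

/-- The function `η ↦ P (η ≤ r)`. -/
noncomputable def massTail (P : Measure S) (r : S → ℝ≥0) (η : ℝ) : ℝ := P.real {x | η ≤ (r x : ℝ)}

lemma meanMeasure_one (P : Measure S) :
    meanMeasure 1 P = (volume.restrict (Ioi (0 : ℝ))).prod P := by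
  simp [meanMeasure]

lemma measurable_stretchOf_comp {P : Measure S} {r : S → ℝ≥0} (hr : Measurable r) :
    Measurable fun x => stretchOf (massTail P r) (r x) :=
  (stretchOf_mono _).measurable.comp (measurable_coe_nnreal_real.comp hr)

/-- The set of arrivals `(t, x)` that the sampler accepts. -/
def acceptRegion (P : Measure S) (r : S → ℝ≥0) : Set (ℝ × S) :=
  {a | ENNReal.ofReal a.1 < stretchOf (massTail P r) (r a.2)}

lemma measurableSet_acceptRegion {P : Measure S} {r : S → ℝ≥0} (hr : Measurable r) : MeasurableSet (acceptRegion P r) :=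
  measurableSet_lt measurable_fst.ennreal_ofReal
    ((measurable_stretchOf_comp hr).comp measurable_snd)

variable {P : Measure S} [IsProbabilityMeasure P] {r : S → ℝ≥0}

lemma ofReal_massTail (P : Measure S) [IsProbabilityMeasure P] (r : S → ℝ≥0) (η : ℝ) :
    ENNReal.ofReal (massTail P r η) = P {x | η ≤ (r x : ℝ)} :=
  ofReal_measureReal

/-- Tonelli on the region η ≤ r(x). -/
lemma lintegral_mul_measure_le (hr : Measurable r) {E : Set ℝ} (hE : MeasurableSet E)
    {g : ℝ → ℝ≥0∞} (hg : Measurable g) {B : Set S} (hB : MeasurableSet B) :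
    ∫⁻ η in E, g η * P (B ∩ {x | η ≤ (r x : ℝ)}) =
      ∫⁻ x in B, (∫⁻ η in E ∩ Iic (r x : ℝ), g η) ∂P := by
  have hrm : Measurable fun x => (r x : ℝ) := measurable_coe_nnreal_real.comp hr
  have hset : MeasurableSet {p : ℝ × S | p.1 ≤ (r p.2 : ℝ)} :=
    measurableSet_le measurable_fst (hrm.comp measurable_snd)
  let G : ℝ → S → ℝ≥0∞ := fun η x =>
    {p : ℝ × S | p.1 ≤ (r p.2 : ℝ)}.indicator (fun p => g p.1) (η, x)
  have hG : Measurable (Function.uncurry G) := (hg.comp measurable_fst).indicator hset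
  calc ∫⁻ η in E, g η * P (B ∩ {x | η ≤ (r x : ℝ)})
      = ∫⁻ η in E, ∫⁻ x in B, G η x ∂P := by
        refine setLIntegral_congr_fun hE fun η _ => ?_
        have hm : MeasurableSet {x | η ≤ (r x : ℝ)} := measurableSet_le measurable_const hrm
        have : ∀ x, G η x = {x | η ≤ (r x : ℝ)}.indicator (fun _ => g η) x := fun x => by
          simp [G, indicator]
        simp only [this]
        rw [lintegral_indicator_const hm, Measure.restrict_apply hm, inter_comm]
    _ = ∫⁻ x in B, (∫⁻ η in E, G η x) ∂P := lintegral_lintegral_swap hG.aemeasurable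
    _ = _ := by
        refine setLIntegral_congr_fun hB fun x _ => ?_
        have : ∀ η, G η x = (Iic (r x : ℝ)).indicator g η := fun η => by simp [G, indicator]
        simp only [this]
        rw [lintegral_indicator measurableSet_Iic, Measure.restrict_restrict measurableSet_Iic,
          inter_comm]

lemma lintegral_measure_le_Ioi (hr : Measurable r) (η : ℝ) :
    ∫⁻ ζ in Ioi η, P {x | ζ ≤ (r x : ℝ)} = ∫⁻ x, ENNReal.ofReal (r x - η) ∂P := by
  have := lintegral_mul_measure_le (P := P) hr (measurableSet_Ioi (a := η)) (measurable_const (a := 1))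
    MeasurableSet.univ
  simpa [Ioi_inter_Iic] using this

lemma isTail_massTail (hr : Measurable r) (h1 : ∫⁻ x, r x ∂P = 1) : IsTail (massTail P r) := by
  have hanti : Antitone (massTail P r) := fun a b hab =>
    measureReal_mono fun x (hx : b ≤ (r x : ℝ)) => hab.trans hx
  have hlint : ∫⁻ ζ in Ioi 0, ENNReal.ofReal (massTail P r ζ) = 1 := by
    simp only [ofReal_massTail]
    rw [lintegral_measure_le_Ioi hr 0]
    simpa using h1
  have hnn : ∀ t, 0 ≤ massTail P r t := fun _ => measureReal_nonneg
  refine ⟨hanti, hnn, fun _ => measureReal_le_one, ?_, ?_⟩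
  · refine ⟨hanti.measurable.aestronglyMeasurable, ?_⟩
    rw [hasFiniteIntegral_iff_ofReal (ae_of_all _ hnn), hlint]
    exact ENNReal.one_lt_top
  · rw [integral_eq_lintegral_of_nonneg_ae (ae_of_all _ hnn) hanti.measurable.aestronglyMeasurable,
      hlint, ENNReal.toReal_one]

/-- Both sides are ∫ (r − η)⁺ dP: the right by the layer-cake formula, the left by integrating r − η
over {r ≥ η}. -/
lemma excess_massTail (hr : Measurable r) (h1 : ∫⁻ x, r x ∂P = 1) {Q : Measure S}
    [IsProbabilityMeasure Q] (hQ : Q = P.withDensity fun x => (r x : ℝ≥0∞)) {η : ℝ} (hη : 0 ≤ η) :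
    Q.real {x | η ≤ (r x : ℝ)} - η * P.real {x | η ≤ (r x : ℝ)} = excess (massTail P r) η := by
  have hrm : Measurable fun x => (r x : ℝ) := measurable_coe_nnreal_real.comp hr
  have hT := isTail_massTail hr h1
  have hm : MeasurableSet {x | η ≤ (r x : ℝ)} := measurableSet_le measurable_const hrm
  have hF : ENNReal.ofReal (excess (massTail P r) η) = ∫⁻ x, ENNReal.ofReal (r x - η) ∂P := by
    rw [hT.ofReal_excess]
    simp only [ofReal_massTail]
    exact lintegral_measure_le_Ioi hr η
  have key : ENNReal.ofReal (excess (massTail P r) η) +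
      ENNReal.ofReal η * P {x | η ≤ (r x : ℝ)} = Q {x | η ≤ (r x : ℝ)} := by
    rw [hF, hQ, withDensity_apply _ hm, ← lintegral_indicator_const hm,
      ← lintegral_add_right _ (measurable_const.indicator hm), ← lintegral_indicator hm]
    refine lintegral_congr fun x => ?_
    by_cases hx : η ≤ (r x : ℝ)
    · have hx' : x ∈ {x | η ≤ (r x : ℝ)} := hx
      rw [indicator_of_mem hx', indicator_of_mem hx', ← ENNReal.ofReal_add (by linarith) hη]
      simp
    · have hx' : x ∉ {x | η ≤ (r x : ℝ)} := hx
      rw [indicator_of_notMem hx', indicator_of_notMem hx', add_zero, ENNReal.ofReal_eq_zero]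
      linarith
  have := congrArg ENNReal.toReal key
  rw [ENNReal.toReal_add ENNReal.ofReal_ne_top
    (ENNReal.mul_ne_top ENNReal.ofReal_ne_top (measure_ne_top _ _)), ENNReal.toReal_mul,
    ENNReal.toReal_ofReal hη, ENNReal.toReal_ofReal (hT.excess_nonneg η)] at this
  simp only [measureReal_def]
  linarith

lemma stretch_eq_stretchOf (hr : Measurable r) {Q : Measure S}
    [IsProbabilityMeasure Q] (hQ : Q = P.withDensity fun x => (r x : ℝ≥0∞)) (h : ℝ≥0) :
    stretch P Q r h = stretchOf (massTail P r) h := by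
  have h1 : ∫⁻ x, r x ∂P = 1 := by
    rw [← setLIntegral_univ, ← withDensity_apply _ MeasurableSet.univ, ← hQ, measure_univ]
  refine setLIntegral_congr_fun measurableSet_Ioc fun η hη => ?_
  rw [excess_massTail hr h1 hQ hη.1.le]

/-! ### Time strips and their mean measure -/

/-- The part of `A` with times in `(s, t]`. -/
def strip (A : Set (ℝ × S)) (s t : ℝ) : Set (ℝ × S) := A ∩ Prod.fst ⁻¹' Ioc s t

lemma measurableSet_strip {A : Set (ℝ × S)} (hA : MeasurableSet A) (s t : ℝ) :
    MeasurableSet (strip A s t) := hA.inter (measurable_fst measurableSet_Ioc)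

instance : SFinite (meanMeasure 1 P) := by rw [meanMeasure_one]; infer_instance

lemma meanMeasure_strip_le (A : Set (ℝ × S)) {s t : ℝ} :
    meanMeasure 1 P (strip A s t) ≤ ENNReal.ofReal (t - s) := by
  rw [meanMeasure_one]
  calc _ ≤ ((volume.restrict (Ioi (0 : ℝ))).prod P) (Ioc s t ×ˢ univ) :=
        measure_mono fun a ha => ⟨ha.2, mem_univ _⟩
    _ = volume.restrict (Ioi 0) (Ioc s t) := by rw [Measure.prod_prod]; simp
    _ ≤ volume (Ioc s t) := Measure.restrict_apply_le _ _
    _ = _ := Real.volume_Ioc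

lemma meanMeasure_strip_ne_top (A : Set (ℝ × S)) (s t : ℝ) :
    meanMeasure 1 P (strip A s t) ≠ ∞ :=
  ((meanMeasure_strip_le A).trans_lt ENNReal.ofReal_lt_top).ne

lemma volume_setOf_pos_lt (a : ℝ) (b : ℝ≥0∞) :
    volume {t | 0 < t ∧ t ≤ a ∧ ENNReal.ofReal t < b} = min (ENNReal.ofReal a) b := by
  rcases lt_or_ge (ENNReal.ofReal a) b with h | h
  · have : {t | 0 < t ∧ t ≤ a ∧ ENNReal.ofReal t < b} = Ioc 0 a := by
      ext t
      exact ⟨fun ht => ⟨ht.1, ht.2.1⟩, fun ht =>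
        ⟨ht.1, ht.2, (ENNReal.ofReal_le_ofReal ht.2).trans_lt h⟩⟩
    rw [this, min_eq_left h.le]; simp
  · have hb : b ≠ ∞ := (h.trans_lt ENNReal.ofReal_lt_top).ne
    have : {t | 0 < t ∧ t ≤ a ∧ ENNReal.ofReal t < b} = Ioo 0 b.toReal := by
      ext t
      simp only [mem_ofPred_eq, mem_Ioo]
      constructor
      · rintro ⟨h0, _, h2⟩
        exact ⟨h0, (ENNReal.ofReal_lt_iff_lt_toReal h0.le hb).1 h2⟩
      · rintro ⟨h0, h2⟩
        have h3 := (ENNReal.ofReal_lt_iff_lt_toReal h0.le hb).2 h2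
        refine ⟨h0, ?_, h3⟩
        by_contra hlt
        exact absurd (h3.trans_le h) (not_lt.2 (ENNReal.ofReal_le_ofReal (not_le.1 hlt).le))
    rw [this, min_eq_right h, Real.volume_Ioo, sub_zero, ENNReal.ofReal_toReal hb]

/-- The section over x has length min(σ(η), σ(r(x))) = σ(min(η, r(x))), the integral of 1/F over 0 <
ζ ≤ η with ζ ≤ r(x). Integrating over x by Tonelli gives ∫_0^η W/F. -/
lemma meanMeasure_strip_acceptRegion (hr : Measurable r) (h1 : ∫⁻ x, r x ∂P = 1) {η : ℝ}
    (hη : η ∈ excessSupport (massTail P r)) :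
    meanMeasure 1 P (strip (acceptRegion P r) 0 (realStretch (massTail P r) η)) =
      ENNReal.ofReal (-Real.log (excess (massTail P r) η)) := by
  have hT := isTail_massTail hr h1
  have hFm : Measurable fun ζ => (ENNReal.ofReal (excess (massTail P r) ζ))⁻¹ :=
    hT.continuous_excess.measurable.ennreal_ofReal.inv
  rw [meanMeasure_one, Measure.prod_apply_symm (measurableSet_strip (measurableSet_acceptRegion hr) _ _)]
  have hB := lintegral_mul_measure_le (P := P) hr (measurableSet_Ioc (a := (0 : ℝ)) (b := η)) hFm
    MeasurableSet.univ
  rw [hT.ofReal_neg_log_excess hη]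
  simp only [ofReal_massTail]
  simp only [univ_inter, Measure.restrict_univ] at hB
  simp only [mul_comm (P _)]
  rw [hB]
  refine lintegral_congr fun x => ?_
  have : (fun t : ℝ => (t, x)) ⁻¹' strip (acceptRegion P r) 0 (realStretch (massTail P r) η) ∩ Ioi 0 =
      {t | 0 < t ∧ t ≤ realStretch (massTail P r) η ∧
        ENNReal.ofReal t < stretchOf (massTail P r) (r x)} := by
    ext t
    simp [strip, acceptRegion]
    tauto
  rw [Measure.restrict_apply' measurableSet_Ioi, this, volume_setOf_pos_lt, ← hT.stretchOf_eq hη,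
    Ioc_inter_Iic, ← (stretchOf_mono (massTail P r)).map_min]
  rfl

/-! ### Survival probability and integrals over the acceptance region -/

/-- The probability that no arrival is accepted by time `t`. -/
noncomputable def survival (P : Measure S) (r : S → ℝ≥0) (t : ℝ) : ℝ≥0∞ :=
  ENNReal.ofReal (Real.exp (-(meanMeasure 1 P (strip (acceptRegion P r) 0 t)).toReal))

lemma survival_realStretch (hr : Measurable r) (h1 : ∫⁻ x, r x ∂P = 1) {η : ℝ}
    (hη : η ∈ excessSupport (massTail P r)) :
    survival P r (realStretch (massTail P r) η) = ENNReal.ofReal (excess (massTail P r) η) := by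
  have hT := isTail_massTail hr h1
  have h0 : 0 ≤ -Real.log (excess (massTail P r) η) :=
    neg_nonneg.2 (Real.log_nonpos hη.2.le (hT.excess_le_one hη.1.le))
  rw [survival, meanMeasure_strip_acceptRegion hr h1 hη, ENNReal.toReal_ofReal h0, neg_neg,
    Real.exp_log hη.2]

lemma survival_antitone (P : Measure S) [IsProbabilityMeasure P] (r : S → ℝ≥0) :
    Antitone (survival P r) := by
  intro s t hst
  refine ENNReal.ofReal_le_ofReal (Real.exp_le_exp.2 (neg_le_neg ?_))
  refine ENNReal.toReal_mono (meanMeasure_strip_ne_top _ _ _) (measure_mono ?_)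
  exact inter_subset_inter_right _ (preimage_mono (Ioc_subset_Ioc_right hst))

/-- Arrivals come at unit rate, so the time interval (s, t] adds at most t − s to the exponent. -/
lemma survival_le_exp_mul (P : Measure S) [IsProbabilityMeasure P] (r : S → ℝ≥0) {s t δ : ℝ}
    (hst : s ≤ t) (hδ : t ≤ s + δ) :
    survival P r s ≤ ENNReal.ofReal (Real.exp δ) * survival P r t := by
  unfold survival
  rw [← ENNReal.ofReal_mul (Real.exp_pos _).le, ← Real.exp_add]
  refine ENNReal.ofReal_le_ofReal (Real.exp_le_exp.2 ?_)
  have h1 : meanMeasure 1 P (strip (acceptRegion P r) 0 t) ≤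
      meanMeasure 1 P (strip (acceptRegion P r) 0 s) + ENNReal.ofReal (t - s) := by
    refine (measure_mono ?_).trans ((measure_union_le _ _).trans
      (add_le_add_right (meanMeasure_strip_le (acceptRegion P r) (s := s) (t := t)) _))
    intro a ha
    rcases le_or_gt a.1 s with h | h
    · exact Or.inl ⟨ha.1, ha.2.1, h⟩
    · exact Or.inr ⟨ha.1, h, ha.2.2⟩
  have h2 := ENNReal.toReal_mono
    (ENNReal.add_ne_top.2 ⟨meanMeasure_strip_ne_top _ _ _, ENNReal.ofReal_ne_top⟩) h1
  rw [ENNReal.toReal_add (meanMeasure_strip_ne_top _ _ _) ENNReal.ofReal_ne_top,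
    ENNReal.toReal_ofReal (by linarith)] at h2
  linarith

/-- At t = σ(η) the survival probability F(η) cancels the Jacobian 1/F(η). The inequality comes from
acceptance, σ(η) < σ(r(x)), which forces η ≤ r(x) by monotonicity. -/
lemma lintegral_survival_mul_le (hr : Measurable r) (h1 : ∫⁻ x, r x ∂P = 1) {g : ℝ → ℝ≥0∞}
    (hg : Measurable g) {B : Set S} (hB : MeasurableSet B) :
    ∫⁻ a in acceptRegion P r ∩ Prod.snd ⁻¹' B, survival P r a.1 * g a.1 ∂(meanMeasure 1 P) ≤
      ∫⁻ η in excessSupport (massTail P r), g (realStretch (massTail P r) η) *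
        P (B ∩ {x | η ≤ (r x : ℝ)}) := by
  have hT := isTail_massTail hr h1
  have hU := measurableSet_acceptRegion (P := P) hr
  have hUB : MeasurableSet (acceptRegion P r ∩ Prod.snd ⁻¹' B) := hU.inter (measurable_snd hB)
  have hsg : Measurable fun a : ℝ × S => survival P r a.1 * g a.1 :=
    ((survival_antitone P r).measurable.mul hg).comp measurable_fst
  rw [meanMeasure_one, ← lintegral_indicator hUB, lintegral_prod _
    (hsg.indicator hUB).aemeasurable]
  have : ∀ t, ∫⁻ x, (acceptRegion P r ∩ Prod.snd ⁻¹' B).indicator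
      (fun a : ℝ × S => survival P r a.1 * g a.1) (t, x) ∂P =
      survival P r t * g t *
        P (B ∩ {x | ENNReal.ofReal t < stretchOf (massTail P r) (r x)}) := by
    intro t
    have hm : MeasurableSet (B ∩ {x | ENNReal.ofReal t < stretchOf (massTail P r) (r x)}) :=
      hB.inter (measurableSet_lt measurable_const (measurable_stretchOf_comp hr))
    rw [← lintegral_indicator_const hm]
    refine lintegral_congr fun x => ?_
    have hiff : (t, x) ∈ acceptRegion P r ∩ Prod.snd ⁻¹' B ↔
        x ∈ B ∩ {x | ENNReal.ofReal t < stretchOf (massTail P r) (r x)} := and_comm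
    by_cases hx : x ∈ B ∩ {x | ENNReal.ofReal t < stretchOf (massTail P r) (r x)}
    · rw [indicator_of_mem hx, indicator_of_mem (hiff.2 hx)]
    · rw [indicator_of_notMem hx, indicator_of_notMem (hiff.not.2 hx)]
  simp only [this]
  rw [hT.lintegral_Ioi_eq]
  refine setLIntegral_mono' hT.measurableSet_excessSupport fun η hη => ?_
  rw [survival_realStretch hr h1 hη, ENNReal.ofReal_inv_of_pos hη.2, ← mul_assoc, ← mul_assoc,
    ENNReal.inv_mul_cancel (by simpa using hη.2) ENNReal.ofReal_ne_top, one_mul]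
  gcongr with x
  intro hx
  rw [← hT.stretchOf_eq hη] at hx
  by_contra hlt
  exact absurd hx (not_lt.2 (stretchOf_mono _ (not_le.1 hlt).le))

lemma lintegral_survival_le (hr : Measurable r) (h1 : ∫⁻ x, r x ∂P = 1)
    {B : Set S} (hB : MeasurableSet B) :
    ∫⁻ a in acceptRegion P r ∩ Prod.snd ⁻¹' B, survival P r a.1 ∂(meanMeasure 1 P) ≤
      P.withDensity (fun x => (r x : ℝ≥0∞)) B := by
  have hT := isTail_massTail hr h1
  have h := lintegral_survival_mul_le hr h1 (measurable_const (a := 1)) hB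
  rw [lintegral_mul_measure_le hr hT.measurableSet_excessSupport measurable_const hB] at h
  simp only [mul_one] at h
  refine h.trans ?_
  rw [withDensity_apply _ hB]
  refine lintegral_mono fun x => ?_
  calc ∫⁻ _ in excessSupport (massTail P r) ∩ Iic (r x : ℝ), 1 ≤ volume (Ioc 0 (r x : ℝ)) := by
        rw [setLIntegral_one]
        exact measure_mono fun η hη => ⟨hη.1.1, hη.2⟩
    _ = r x := by simp

/-- The integral is (1 + b) log(1 + b) − b and the right side is b log b + 1, so b log(1 + 1/b) ≤ 1
and log(1 + b) ≤ b suffice. -/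
lemma lintegral_log_one_add_le (b : ℝ≥0) :
    ∫⁻ η in Ioc 0 (b : ℝ), ENNReal.ofReal (Real.log (1 + η)) ≤
      ENNReal.ofReal (InformationTheory.klFun b) + b := by
  have hb := b.coe_nonneg
  have hcont : ContinuousOn (fun η : ℝ => Real.log (1 + η)) (uIcc 0 (b : ℝ)) := by
    rw [uIcc_of_le hb]
    exact (by fun_prop : Continuous fun η : ℝ => 1 + η).continuousOn.log
      fun x hx => by have := hx.1; positivity
  rw [← ofReal_integral_eq_lintegral_ofReal hcont.intervalIntegrable.1
    ((ae_restrict_iff' measurableSet_Ioc).2 (ae_of_all _ fun x hx =>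
      Real.log_nonneg (by linarith [hx.1]))), ← intervalIntegral.integral_of_le hb,
    intervalIntegral.integral_comp_add_left (fun x => Real.log x) 1, integral_log,
    ← ENNReal.ofReal_coe_nnreal (p := b),
    ← ENNReal.ofReal_add (InformationTheory.klFun_nonneg hb) hb]
  refine ENNReal.ofReal_le_ofReal ?_
  rw [InformationTheory.klFun_apply]
  rcases hb.eq_or_lt with h0 | h0
  · rw [← h0]; simp
  · have e1 : Real.log (1 + b) ≤ Real.log b + 1 / b := by
      have : (1 : ℝ) + b = b * (1 + 1 / b) := by field_simp; ring
      rw [this, Real.log_mul h0.ne' (by positivity)]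
      have := Real.log_le_sub_one_of_pos (show (0 : ℝ) < 1 + 1 / b by positivity)
      linarith
    have e2 : Real.log (1 + b) ≤ b := by
      have := Real.log_le_sub_one_of_pos (show (0 : ℝ) < 1 + b by positivity)
      linarith
    have e3 : (b : ℝ) * Real.log (1 + b) ≤ b * Real.log b + 1 := by
      have := mul_le_mul_of_nonneg_left e1 hb
      rw [mul_add, mul_one_div_cancel h0.ne'] at this
      exact this
    simp only [add_zero, Real.log_one]
    linarith

/-- Since 1 + σ(η) ≤ 1/F(η) + η/F(η), the logarithm splits as log(1 + η) − log F(η). Each term costs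
one nat, the first because ∫ r dP = 1. -/
lemma lintegral_survival_mul_log_le (hr : Measurable r) (h1 : ∫⁻ x, r x ∂P = 1) :
    ∫⁻ a in acceptRegion P r, survival P r a.1 * ENNReal.ofReal (Real.log (1 + a.1))
      ∂(meanMeasure 1 P) ≤ ∫⁻ x, ENNReal.ofReal (InformationTheory.klFun (r x)) ∂P + 2 := by
  have hT := isTail_massTail hr h1
  have hlm : Measurable fun t : ℝ => ENNReal.ofReal (Real.log (1 + t)) := by fun_prop
  have h := lintegral_survival_mul_le hr h1 hlm MeasurableSet.univ
  simp only [preimage_univ, inter_univ, univ_inter] at h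
  refine h.trans ?_
  have hD := hT.measurableSet_excessSupport
  calc _ ≤ ∫⁻ η in excessSupport (massTail P r),
        (ENNReal.ofReal (Real.log (1 + η)) * P (univ ∩ {x | η ≤ (r x : ℝ)}) +
        ENNReal.ofReal (massTail P r η) *
          ENNReal.ofReal (-Real.log (excess (massTail P r) η))) := by
        refine setLIntegral_mono' hD fun η hη => ?_
        rw [ofReal_massTail, univ_inter, mul_comm (P _) (ENNReal.ofReal (-_)), ← add_mul,
          ← ENNReal.ofReal_add (Real.log_nonneg (by linarith [hη.1]))
          (neg_nonneg.2 (Real.log_nonpos hη.2.le (hT.excess_le_one hη.1.le)))]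
        gcongr
        rw [← sub_eq_add_neg, ← Real.log_div (by linarith [hη.1]) hη.2.ne']
        have h3 := hT.realStretch_pos hη
        refine Real.log_le_log (by linarith) ?_
        have h4 := hT.realStretch_le hη
        rw [add_div]
        gcongr
        exact (one_le_div hη.2).2 (hT.excess_le_one hη.1.le)
    _ = (∫⁻ η in excessSupport (massTail P r),
        ENNReal.ofReal (Real.log (1 + η)) * P (univ ∩ {x | η ≤ (r x : ℝ)})) +
        ∫⁻ η in excessSupport (massTail P r), ENNReal.ofReal (massTail P r η) *
          ENNReal.ofReal (-Real.log (excess (massTail P r) η)) := by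
        refine lintegral_add_right _ ?_
        have h2 := hT.continuous_excess.measurable
        have h3 := hT.anti.measurable
        fun_prop
    _ ≤ (∫⁻ x, ENNReal.ofReal (InformationTheory.klFun (r x)) ∂P + 1) + 1 := by
        refine add_le_add ?_ hT.lintegral_mul_neg_log_excess_le
        rw [lintegral_mul_measure_le hr hD hlm MeasurableSet.univ, Measure.restrict_univ, ← h1,
          ← lintegral_add_right _ hr.coe_nnreal_ennreal]
        refine lintegral_mono fun x => (lintegral_mono_set ?_).trans (lintegral_log_one_add_le (r x))
        exact fun η hη => ⟨hη.1.1, hη.2⟩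
    _ = _ := by rw [add_assoc, one_add_one_eq_two]

lemma klDiv_withDensity (hr : Measurable r)
    [IsFiniteMeasure (P.withDensity fun x => (r x : ℝ≥0∞))] :
    InformationTheory.klDiv (P.withDensity fun x => (r x : ℝ≥0∞)) P =
      ∫⁻ x, ENNReal.ofReal (InformationTheory.klFun (r x)) ∂P := by
  rw [InformationTheory.klDiv_eq_lintegral_klFun_of_ac (withDensity_absolutelyContinuous _ _)]
  refine lintegral_congr_ae ?_
  filter_upwards [Measure.rnDeriv_withDensity P hr.coe_nnreal_ennreal] with x hx
  rw [hx]; simp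

end GPRS

namespace GPRS

open Set Filter Topology

/-! ### Measurability of hitting indices -/

lemma measurable_sInf_setOf {α : Type*} [MeasurableSpace α] {E : ℕ → Set α}
    (hE : ∀ n, MeasurableSet (E n)) : Measurable fun a => sInf {n | a ∈ E n} := by
  classical
  refine measurable_to_countable' fun k => ?_
  -- Since `sInf ∅ = 0`, the points lying in no `E n` belong to the preimage of 0.
  have : (fun a => sInf {n | a ∈ E n}) ⁻¹' {k} =
      (E k ∩ ⋂ j ∈ Finset.range k, (E j)ᶜ) ∪ (if k = 0 then (⋃ n, E n)ᶜ else ∅) := by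
    ext a
    simp only [mem_preimage, mem_singleton_iff, mem_union, mem_inter_iff, mem_iInter, mem_compl_iff,
      Finset.mem_range]
    constructor
    · intro h
      by_cases hne : {n | a ∈ E n}.Nonempty
      · refine Or.inl ⟨h ▸ Nat.sInf_mem hne, fun j hj => ?_⟩
        exact Nat.notMem_of_lt_sInf (h ▸ hj)
      · right
        have h0 : {n | a ∈ E n} = ∅ := not_nonempty_iff_eq_empty.1 hne
        rw [h0, Nat.sInf_empty] at h
        rw [if_pos h.symm, mem_compl_iff, mem_iUnion]
        rintro ⟨n, hn⟩
        exact hne ⟨n, hn⟩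
    · rintro (⟨h1, h2⟩ | h)
      · refine le_antisymm (Nat.sInf_le h1) (not_lt.1 fun hlt => ?_)
        exact h2 _ hlt (Nat.sInf_mem (s := {n | a ∈ E n}) ⟨k, h1⟩)
      · split_ifs at h with hk
        · have h0 : {n | a ∈ E n} = ∅ := by
            ext n
            exact ⟨fun hn => h (mem_iUnion.2 ⟨n, hn⟩), fun hn => hn.elim⟩
          rw [h0, Nat.sInf_empty, hk]
        · exact h.elim
  rw [this]
  refine MeasurableSet.union ((hE k).inter
    (Finset.measurableSet_biInter _ fun j _ => (hE j).compl)) ?_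
  split_ifs
  · exact (MeasurableSet.iUnion hE).compl
  · exact MeasurableSet.empty

/-! ### Moments of the Poisson distribution -/

lemma lintegral_id_poissonMeasure (m : ℝ≥0) : ∫⁻ n, (n : ℝ≥0∞) ∂(poissonMeasure m) = m := by
  have hs : ∑' n : ℕ, ENNReal.ofReal (Real.exp (-m) * m ^ n / n.factorial) = 1 := by
    rw [← ENNReal.ofReal_tsum_of_nonneg (fun n => by positivity)
      (hasSum_one_poissonMeasure m).summable, (hasSum_one_poissonMeasure m).tsum_eq,
      ENNReal.ofReal_one]
  rw [lintegral_countable']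
  simp only [poissonMeasure_singleton]
  rw [tsum_eq_zero_add' ENNReal.summable]
  simp only [Nat.cast_zero, zero_mul, zero_add]
  have : ∀ n : ℕ, ((n + 1 : ℕ) : ℝ≥0∞) *
      ENNReal.ofReal (Real.exp (-m) * m ^ (n + 1) / (n + 1).factorial) =
      m * ENNReal.ofReal (Real.exp (-m) * m ^ n / n.factorial) := by
    intro n
    rw [← ENNReal.ofReal_natCast, ← ENNReal.ofReal_coe_nnreal (p := m),
      ← ENNReal.ofReal_mul (by positivity), ← ENNReal.ofReal_mul (by positivity)]
    congr 1
    have hf : (n.factorial : ℝ) ≠ 0 := by positivity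
    rw [Nat.factorial_succ]
    push_cast
    field_simp
    ring
  simp only [this]
  rw [ENNReal.tsum_mul_left, hs, mul_one]

/-- Jensen through the tangent line of the logarithm at 1 + m. The negative term is moved to the
left so that all terms stay in `ℝ≥0∞`. -/
lemma lintegral_log_poissonMeasure_le (m : ℝ≥0) :
    ∫⁻ n, ENNReal.ofReal (Real.log (1 + n)) ∂(poissonMeasure m) ≤
      ENNReal.ofReal (Real.log (1 + m)) := by
  have hpt : ∀ n : ℕ, ENNReal.ofReal (Real.log (1 + n)) + ENNReal.ofReal (m / (1 + m)) ≤
      ENNReal.ofReal (Real.log (1 + m)) + ENNReal.ofReal (1 / (1 + m)) * n := by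
    intro n
    have hm := m.coe_nonneg
    have hn : (0 : ℝ) ≤ n := n.cast_nonneg
    have hlm : 0 ≤ Real.log (1 + (m : ℝ)) := Real.log_nonneg (by linarith)
    rw [← ENNReal.ofReal_natCast, ← ENNReal.ofReal_mul (by positivity),
      ← ENNReal.ofReal_add (Real.log_nonneg (by linarith)) (by positivity),
      ← ENNReal.ofReal_add hlm (by positivity)]
    refine ENNReal.ofReal_le_ofReal ?_
    have h := Real.log_le_sub_one_of_pos (show (0 : ℝ) < (1 + n) / (1 + m) by positivity)
    rw [Real.log_div (by positivity) (by positivity)] at h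
    have : (1 + (n : ℝ)) / (1 + m) - 1 = 1 / (1 + m) * n - m / (1 + m) := by
      field_simp; ring
    linarith
  have hi := lintegral_mono (μ := poissonMeasure m) hpt
  rw [lintegral_add_right _ measurable_const, lintegral_add_right _ (Measurable.of_discrete),
    lintegral_const_mul _ (Measurable.of_discrete), lintegral_id_poissonMeasure, lintegral_const,
    lintegral_const, measure_univ, mul_one, mul_one, ← ENNReal.ofReal_coe_nnreal (p := m),
    ← ENNReal.ofReal_mul (by positivity), one_div_mul_eq_div] at hi
  exact (ENNReal.add_le_add_iff_right ENNReal.ofReal_ne_top).1 hi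

/-! ### Counts of a Poisson process -/

lemma count_eq_zero {S : Type*} {p : ℕ → ℝ × S} {A : Set (ℝ × S)} :
    count p A = 0 ↔ ∀ n, p n ∉ A := by
  rw [count, encard_eq_zero, eq_empty_iff_forall_notMem]
  rfl

variable {S : Type*} [MeasurableSpace S]

lemma measurable_count {A : Set (ℝ × S)} (hA : MeasurableSet A) :
    Measurable fun p : ℕ → ℝ × S => count p A := by
  -- In `ℝ≥0∞` the count is a series of indicators. As `ℕ∞` is countable, measurability then
  -- transfers through singletons.
  have h : ∀ p : ℕ → ℝ × S, ((count p A : ℕ∞) : ℝ≥0∞) = ∑' n, A.indicator 1 (p n) := by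
    intro p
    rw [count, ← ENNReal.tsum_set_one, tsum_subtype {n | p n ∈ A} fun _ => (1 : ℝ≥0∞)]
    rfl
  have hm : Measurable fun p : ℕ → ℝ × S => ((count p A : ℕ∞) : ℝ≥0∞) := by
    simp only [h]
    exact Measurable.tsum fun n =>
      (measurable_one.indicator hA).comp (measurable_pi_apply n)
  refine measurable_to_countable' fun k => ?_
  have : (fun p : ℕ → ℝ × S => count p A) ⁻¹' {k} =
      (fun p : ℕ → ℝ × S => ((count p A : ℕ∞) : ℝ≥0∞)) ⁻¹' {(k : ℝ≥0∞)} := by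
    ext p; simp
  rw [this]
  exact hm (measurableSet_singleton _)

namespace IsPoissonProcess

variable {Ω : Type*} [MeasurableSpace Ω] {P : Measure S} {Pr : Measure Ω} {proc : Ω → ℕ → ℝ × S}

lemma measurable_count_comp (h : IsPoissonProcess 1 P Pr proc) {A : Set (ℝ × S)}
    (hA : MeasurableSet A) : Measurable fun ω => count (proc ω) A :=
  (measurable_count hA).comp h.measurable

lemma lintegral_count (h : IsPoissonProcess 1 P Pr proc) {A : Set (ℝ × S)}
    (hA : MeasurableSet A) (hfin : meanMeasure 1 P A ≠ ∞) (f : ℕ∞ → ℝ≥0∞) :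
    ∫⁻ ω, f (count (proc ω) A) ∂Pr =
      ∫⁻ n : ℕ, f n ∂(poissonMeasure (meanMeasure 1 P A).toNNReal) := by
  rw [← lintegral_map (μ := Pr) (Measurable.of_discrete (f := f)) (h.measurable_count_comp hA),
    h.poisson A hA hfin, lintegral_map Measurable.of_discrete Measurable.of_discrete]

lemma measure_count_eq_zero (h : IsPoissonProcess 1 P Pr proc) {A : Set (ℝ × S)}
    (hA : MeasurableSet A) (hfin : meanMeasure 1 P A ≠ ∞) :
    Pr {ω | count (proc ω) A = 0} = ENNReal.ofReal (Real.exp (-(meanMeasure 1 P A).toReal)) := by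
  have h1 : Pr.map (fun ω => count (proc ω) A) {0} = Pr {ω | count (proc ω) A = 0} :=
    Measure.map_apply (h.measurable_count_comp hA) (measurableSet_singleton _)
  rw [← h1, h.poisson A hA hfin, Measure.map_apply Measurable.of_discrete
    (measurableSet_singleton _)]
  have : (Nat.cast : ℕ → ℕ∞) ⁻¹' {0} = {0} := by ext; simp
  rw [this, poissonMeasure_singleton]
  simp [ENNReal.toReal]

lemma measure_count_ne_zero_le [IsProbabilityMeasure Pr] (h : IsPoissonProcess 1 P Pr proc)
    {A : Set (ℝ × S)} (hA : MeasurableSet A) (hfin : meanMeasure 1 P A ≠ ∞) :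
    Pr {ω | count (proc ω) A ≠ 0} ≤ meanMeasure 1 P A := by
  have hm : MeasurableSet {ω | count (proc ω) A = 0} :=
    h.measurable_count_comp hA (measurableSet_singleton _)
  have : {ω | count (proc ω) A ≠ 0} = {ω | count (proc ω) A = 0}ᶜ := rfl
  rw [this, prob_compl_eq_one_sub hm, h.measure_count_eq_zero hA hfin, ← ENNReal.ofReal_one,
    ← ENNReal.ofReal_sub _ (Real.exp_pos _).le]
  refine (ENNReal.ofReal_le_ofReal ?_).trans_eq (ENNReal.ofReal_toReal hfin)
  linarith [Real.add_one_le_exp (-(meanMeasure 1 P A).toReal)]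

lemma ae_time_pos [IsProbabilityMeasure Pr] (h : IsPoissonProcess 1 P Pr proc) [SFinite P] :
    ∀ᵐ ω ∂Pr, ∀ n, 0 < (proc ω n).1 := by
  have hA : MeasurableSet (Prod.fst ⁻¹' Iic 0 : Set (ℝ × S)) := measurable_fst measurableSet_Iic
  have h0 : meanMeasure 1 P (Prod.fst ⁻¹' Iic 0) = 0 := by
    rw [meanMeasure_one, ← prod_univ, Measure.prod_prod, Measure.restrict_apply measurableSet_Iic,
      Iic_inter_Ioi]
    simp
  have h1 := h.measure_count_ne_zero_le hA (by simp [h0])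
  rw [h0, nonpos_iff_eq_zero] at h1
  have h2 : ∀ᵐ ω ∂Pr, count (proc ω) (Prod.fst ⁻¹' Iic 0) = 0 := h1
  filter_upwards [h2] with ω hω n
  exact not_le.1 (count_eq_zero.1 hω n)

lemma lintegral_mul_mul (h : IsPoissonProcess 1 P Pr proc) {A B C : Set (ℝ × S)}
    (hA : MeasurableSet A) (hB : MeasurableSet B) (hC : MeasurableSet C)
    (hAB : Disjoint A B) (hAC : Disjoint A C) (hBC : Disjoint B C) (f g l : ℕ∞ → ℝ≥0∞) :
    ∫⁻ ω, f (count (proc ω) A) * g (count (proc ω) B) * l (count (proc ω) C) ∂Pr =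
      (∫⁻ ω, f (count (proc ω) A) ∂Pr) * (∫⁻ ω, g (count (proc ω) B) ∂Pr) *
        ∫⁻ ω, l (count (proc ω) C) ∂Pr := by
  -- Independence is given for sequences of disjoint sets, so the three sets are padded with `∅`.
  let E : ℕ → Set (ℝ × S) := fun i => match i with
    | 0 => A | 1 => B | 2 => C | _ => ∅
  let φ : ℕ → ℕ∞ → ℝ≥0∞ := fun i => match i with
    | 0 => f | 1 => g | _ => l
  have hE : ∀ i, MeasurableSet (E i) := by
    rintro (_ | _ | _ | i) <;> simp [E, hA, hB, hC]
  have hd : Pairwise fun i j => Disjoint (E i) (E j) := by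
    rintro (_ | _ | _ | i) (_ | _ | _ | j) hij <;>
      simp_all [E, hAB.symm, hAC.symm, hBC.symm]
  have hind := (h.indep E hE hd).comp φ fun _ => Measurable.of_discrete
  have := lintegral_prod_eq_prod_lintegral_of_indepFun (Finset.range 3) _ hind fun i =>
    (Measurable.of_discrete (f := φ i)).comp (h.measurable_count_comp (hE i))
  simpa [Finset.prod_range_succ, E, φ] using this

end IsPoissonProcess

/-! ### The first accepted arrival -/

/-- The index, starting from zero, of the first arrival in `U`. -/
noncomputable def firstIndex {S : Type*} (U : Set (ℝ × S)) (p : ℕ → ℝ × S) : ℕ := sInf {n | p n ∈ U}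

lemma measurable_firstIndex {U : Set (ℝ × S)} (hU : MeasurableSet U) :
    Measurable (firstIndex U) :=
  measurable_sInf_setOf (E := fun n => {p : ℕ → ℝ × S | p n ∈ U})
    fun n => measurable_pi_apply n hU

lemma measurable_eval_nat {α : Type*} [MeasurableSpace α] {β : Type*} [MeasurableSpace β]
    {f : α → ℕ → β} {N : α → ℕ} (hf : Measurable f) (hN : Measurable N) :
    Measurable fun a => f a (N a) := by
  have : Measurable fun q : ℕ × (ℕ → β) => q.2 q.1 :=
    measurable_from_prod_countable_right fun n => measurable_pi_apply n
  exact this.comp (hN.prodMk hf)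

/-- Counted from zero, the first index in U is the number of earlier arrivals, and these all lie
outside U. -/
lemma firstIndex_le_count {S : Type*} {U : Set (ℝ × S)} {p : ℕ → ℝ × S} (hpos : ∀ n, 0 < (p n).1)
    (hmono : StrictMono fun n => (p n).1) {t : ℝ} (ht : (p (firstIndex U p)).1 ≤ t) :
    (firstIndex U p : ℕ∞) ≤ count p (strip Uᶜ 0 t) := by
  have : ((Finset.range (firstIndex U p) : Finset ℕ) : Set ℕ).encard = firstIndex U p := by
    rw [encard_coe_eq_coe_finsetCard, Finset.card_range]
  rw [← this]
  refine encard_le_encard fun n hn => ?_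
  have hn' : n < firstIndex U p := by simpa using hn
  exact ⟨Nat.notMem_of_lt_sInf hn', hpos n, (hmono hn').le.trans ht⟩

lemma count_strip_eq_zero {S : Type*} {U : Set (ℝ × S)} {p : ℕ → ℝ × S}
    (hmono : StrictMono fun n => (p n).1) {t : ℝ} (ht : t < (p (firstIndex U p)).1) :
    count p (strip U 0 t) = 0 := by
  refine count_eq_zero.2 fun n hn => ?_
  have h1 : firstIndex U p ≤ n := Nat.sInf_le hn.1
  exact absurd (hmono.monotone h1) (not_le.2 (hn.2.2.trans_lt ht))

lemma exists_mem_Ioc_mul {δ t : ℝ} (hδ : 0 < δ) (ht : 0 < t) :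
    ∃ k : ℕ, t ∈ Ioc (k * δ) ((k + 1) * δ) := by
  refine ⟨(⌈t / δ⌉₊ - 1), ?_⟩
  have h0 : 0 < ⌈t / δ⌉₊ := Nat.ceil_pos.2 (by positivity)
  have hcast : ((⌈t / δ⌉₊ - 1 : ℕ) : ℝ) = (⌈t / δ⌉₊ : ℝ) - 1 := by
    rw [Nat.cast_sub h0, Nat.cast_one]
  rw [hcast]
  have h1 := Nat.le_ceil (t / δ)
  have h2 := Nat.ceil_lt_add_one (show 0 ≤ t / δ by positivity)
  rw [div_le_iff₀ hδ] at h1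
  have h3 : (⌈t / δ⌉₊ : ℝ) * δ < t + δ := by
    have := mul_lt_mul_of_pos_right h2 hδ
    rwa [add_mul, div_mul_cancel₀ _ hδ.ne', one_mul] at this
  constructor <;> nlinarith

variable {Ω : Type*} [MeasurableSpace Ω] {P : Measure S} [IsProbabilityMeasure P] {r : S → ℝ≥0}
  {Pr : Measure Ω} [IsProbabilityMeasure Pr] {proc : Ω → ℕ → ℝ × S}

/-- If the first accepted arrival lies in A at a time in (kδ, (k+1)δ], then no arrival is accepted
up to kδ, A has an arrival in that cell, and the index is at most the number of rejected arrivals up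
to (k+1)δ. These counts concern disjoint sets, so the expectation factorises. The factor e^δ pays
for taking the survival probability at the left end of the cell. -/
lemma IsPoissonProcess.lintegral_firstIndex_le (h : IsPoissonProcess 1 P Pr proc)
    (hr : Measurable r) {A : Set (ℝ × S)} (hA : MeasurableSet A) (hAU : A ⊆ acceptRegion P r)
    {L : ℕ∞ → ℝ≥0∞} (hL : Monotone L) {g : ℝ → ℝ≥0∞} (hg : Measurable g) {δ : ℝ} (hδ : 0 < δ)
    (hLg : ∀ (k : ℕ), ∀ t ∈ Ioc (k * δ) ((k + 1) * δ),
      ∫⁻ ω, L (count (proc ω) (strip (acceptRegion P r)ᶜ 0 ((k + 1) * δ))) ∂Pr ≤ g t) :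
    ∫⁻ ω, {ω | proc ω (firstIndex (acceptRegion P r) (proc ω)) ∈ A}.indicator
        (fun ω => L (firstIndex (acceptRegion P r) (proc ω))) ω ∂Pr ≤
      ENNReal.ofReal (Real.exp δ) *
        ∫⁻ a in A, survival P r a.1 * g a.1 ∂(meanMeasure 1 P) := by
  classical
  set U := acceptRegion P r
  have hU : MeasurableSet U := measurableSet_acceptRegion hr
  let f0 : ℕ∞ → ℝ≥0∞ := fun c => if c = 0 then 1 else 0
  let f1 : ℕ∞ → ℝ≥0∞ := fun c => if c ≠ 0 then 1 else 0
  let s : ℕ → ℝ := fun k => k * δ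
  have hs : ∀ k : ℕ, s (k + 1) = (k + 1) * δ := fun k => by simp [s]
  have hsm : Monotone s := fun i j hij =>
    mul_le_mul_of_nonneg_right (Nat.cast_le.2 hij) hδ.le
  have hUk : ∀ k, MeasurableSet (strip U 0 (s k)) := fun k => measurableSet_strip hU _ _
  have hAk : ∀ k, MeasurableSet (strip A (s k) (s (k + 1))) := fun k => measurableSet_strip hA _ _
  have hCk : ∀ k, MeasurableSet (strip Uᶜ 0 (s (k + 1))) := fun k =>
    measurableSet_strip hU.compl _ _
  have hi0 : ∀ k, ∫⁻ ω, f0 (count (proc ω) (strip U 0 (s k))) ∂Pr = survival P r (s k) := by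
    intro k
    have := lintegral_indicator_one (μ := Pr) (s := {ω | count (proc ω) (strip U 0 (s k)) = 0})
      (h.measurable_count_comp (hUk k) (measurableSet_singleton 0))
    rw [survival, ← h.measure_count_eq_zero (hUk k) (meanMeasure_strip_ne_top _ _ _), ← this]
    exact lintegral_congr fun ω => by simp [f0, indicator]
  have hi1 : ∀ k, ∫⁻ ω, f1 (count (proc ω) (strip A (s k) (s (k + 1)))) ∂Pr ≤
      meanMeasure 1 P (strip A (s k) (s (k + 1))) := by
    intro k
    have := lintegral_indicator_one (μ := Pr)
      (s := {ω | count (proc ω) (strip A (s k) (s (k + 1))) ≠ 0})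
      (h.measurable_count_comp (hAk k) (measurableSet_singleton 0).compl)
    refine le_trans (le_of_eq ?_)
      (h.measure_count_ne_zero_le (hAk k) (meanMeasure_strip_ne_top _ _ _))
    rw [← this]
    exact lintegral_congr fun ω => by simp [f1, indicator]
  calc _ ≤ ∫⁻ ω, ∑' k : ℕ, f0 (count (proc ω) (strip U 0 (s k))) *
          f1 (count (proc ω) (strip A (s k) (s (k + 1)))) *
          L (count (proc ω) (strip Uᶜ 0 (s (k + 1)))) ∂Pr := by
        refine lintegral_mono_ae ?_
        filter_upwards [h.ae_time_pos, h.strictMono] with ω hpos hmono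
        by_cases hω : proc ω (firstIndex U (proc ω)) ∈ A
        · rw [indicator_of_mem (s := {ω | proc ω (firstIndex U (proc ω)) ∈ A}) hω]
          obtain ⟨k, hk⟩ := exists_mem_Ioc_mul hδ (hpos (firstIndex U (proc ω)))
          rw [← hs] at hk
          refine le_trans ?_ (ENNReal.le_tsum k)
          have c0 : count (proc ω) (strip U 0 (s k)) = 0 := count_strip_eq_zero hmono hk.1
          have c1 : count (proc ω) (strip A (s k) (s (k + 1))) ≠ 0 := fun hc =>
            count_eq_zero.1 hc _ ⟨hω, hk⟩
          simpa [f0, f1, c0, c1] using hL (firstIndex_le_count hpos hmono hk.2)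
        · rw [indicator_of_notMem (s := {ω | proc ω (firstIndex U (proc ω)) ∈ A}) hω]
          exact zero_le
    _ = ∑' k : ℕ, ∫⁻ ω, f0 (count (proc ω) (strip U 0 (s k))) *
          f1 (count (proc ω) (strip A (s k) (s (k + 1)))) *
          L (count (proc ω) (strip Uᶜ 0 (s (k + 1)))) ∂Pr := by
        refine lintegral_tsum fun k => Measurable.aemeasurable ?_
        exact (((Measurable.of_discrete (f := f0)).comp (h.measurable_count_comp (hUk k))).mul
          ((Measurable.of_discrete (f := f1)).comp (h.measurable_count_comp (hAk k)))).mul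
          ((Measurable.of_discrete (f := L)).comp (h.measurable_count_comp (hCk k)))
    _ ≤ ∑' k : ℕ, ∫⁻ a in strip A (s k) (s (k + 1)),
          ENNReal.ofReal (Real.exp δ) * (survival P r a.1 * g a.1) ∂(meanMeasure 1 P) := by
        refine ENNReal.tsum_le_tsum fun k => ?_
        rw [h.lintegral_mul_mul (hUk k) (hAk k) (hCk k)
          (disjoint_left.2 fun a ha hb => absurd ha.2.2 (not_le.2 hb.2.1))
          (disjoint_left.2 fun a ha hb => hb.1 ha.1)
          (disjoint_left.2 fun a ha hb => hb.1 (hAU ha.1)), hi0]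
        calc _ ≤ survival P r (s k) * meanMeasure 1 P (strip A (s k) (s (k + 1))) *
              ∫⁻ ω, L (count (proc ω) (strip Uᶜ 0 (s (k + 1)))) ∂Pr := by
              gcongr
              exact hi1 k
          _ = ∫⁻ _ in strip A (s k) (s (k + 1)), survival P r (s k) *
              ∫⁻ ω, L (count (proc ω) (strip Uᶜ 0 (s (k + 1)))) ∂Pr ∂(meanMeasure 1 P) := by
              rw [setLIntegral_const]; ring
          _ ≤ _ := by
              refine setLIntegral_mono' (hAk k) fun a ha => ?_
              rw [← mul_assoc]
              refine mul_le_mul' (survival_le_exp_mul P r ha.2.1.le ?_) ?_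
              · refine ha.2.2.trans_eq ?_
                rw [hs]; simp only [s]; ring
              · have := hLg k a.1 ⟨ha.2.1, ha.2.2.trans_eq (hs k)⟩
                rwa [← hs] at this
    _ = ∫⁻ a in ⋃ k, strip A (s k) (s (k + 1)),
          ENNReal.ofReal (Real.exp δ) * (survival P r a.1 * g a.1) ∂(meanMeasure 1 P) := by
        refine (lintegral_iUnion hAk ?_ _).symm
        intro i j hij
        refine disjoint_left.2 fun a ha hb => ?_
        rcases lt_or_gt_of_ne hij with hlt | hlt
        · exact absurd (hb.2.1.trans_le ha.2.2) (not_lt.2 (hsm hlt))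
        · exact absurd (ha.2.1.trans_le hb.2.2) (not_lt.2 (hsm hlt))
    _ ≤ ∫⁻ a in A,
          ENNReal.ofReal (Real.exp δ) * (survival P r a.1 * g a.1) ∂(meanMeasure 1 P) :=
        lintegral_mono_set (iUnion_subset fun k a ha => ha.1)
    _ = _ := by
        refine lintegral_const_mul _ ?_
        exact ((survival_antitone P r).measurable.comp measurable_fst).mul (hg.comp measurable_fst)

end GPRS

namespace GPRS

open Set Filter Topology

/-! ### Greedy Poisson rejection sampling with a fixed target -/

lemma le_of_forall_pos_le_exp_mul {a b : ℝ≥0∞}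
    (h : ∀ δ : ℝ, 0 < δ → a ≤ ENNReal.ofReal (Real.exp δ) * (b + ENNReal.ofReal δ)) : a ≤ b := by
  have h1 : Tendsto (fun δ : ℝ => ENNReal.ofReal (Real.exp δ)) (𝓝[>] 0) (𝓝 1) := by
    have : Tendsto (fun δ : ℝ => ENNReal.ofReal (Real.exp δ)) (𝓝 0)
        (𝓝 (ENNReal.ofReal (Real.exp 0))) :=
      (ENNReal.continuous_ofReal.comp Real.continuous_exp).tendsto 0
    simp only [Real.exp_zero, ENNReal.ofReal_one] at this
    exact this.mono_left nhdsWithin_le_nhds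
  have h2 : Tendsto (fun δ : ℝ => b + ENNReal.ofReal δ) (𝓝[>] 0) (𝓝 b) := by
    have : Tendsto (fun δ : ℝ => b + ENNReal.ofReal δ) (𝓝 0) (𝓝 (b + ENNReal.ofReal 0)) :=
      (continuous_const.add ENNReal.continuous_ofReal).tendsto 0
    simp only [ENNReal.ofReal_zero, add_zero] at this
    exact this.mono_left nhdsWithin_le_nhds
  have h3 := ENNReal.Tendsto.mul h1 (Or.inl one_ne_zero) h2 (Or.inr ENNReal.one_ne_top)
  rw [one_mul] at h3
  refine ge_of_tendsto h3 ?_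
  filter_upwards [self_mem_nhdsWithin] with δ hδ using h δ hδ

lemma lintegral_density {S : Type*} [MeasurableSpace S] {P : Measure S} {r : S → ℝ≥0}
    (Q : Measure S) [IsProbabilityMeasure Q]
    (hQ : Q = P.withDensity fun x => (r x : ℝ≥0∞)) : ∫⁻ x, r x ∂P = 1 := by
  rw [← setLIntegral_univ, ← withDensity_apply _ MeasurableSet.univ, ← hQ, measure_univ]

variable {S : Type*} [MeasurableSpace S]
  {Ω : Type*} [MeasurableSpace Ω] {P : Measure S} [IsProbabilityMeasure P] {r : S → ℝ≥0}
  {Pr : Measure Ω} {proc : Ω → ℕ → ℝ × S}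

namespace IsPoissonProcess

/-- Nothing is accepted by time σ(η) with probability F(η), and F takes arbitrarily small positive
values. -/
lemma ae_exists_mem_acceptRegion (h : IsPoissonProcess 1 P Pr proc) (hr : Measurable r)
    (h1 : ∫⁻ x, r x ∂P = 1) : ∀ᵐ ω ∂Pr, ∃ n, proc ω n ∈ acceptRegion P r := by
  have hT := isTail_massTail hr h1
  have hU : MeasurableSet (acceptRegion P r) := measurableSet_acceptRegion hr
  rw [ae_iff, ← nonpos_iff_eq_zero]
  refine ENNReal.le_of_forall_pos_le_add fun ε hε _ => ?_
  rw [zero_add]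
  obtain ⟨η, hη, hlt⟩ := hT.exists_excess_lt (NNReal.coe_pos.2 hε)
  calc Pr {ω | ¬∃ n, proc ω n ∈ acceptRegion P r}
      ≤ Pr {ω | count (proc ω) (strip (acceptRegion P r) 0 (realStretch (massTail P r) η)) = 0} :=
        measure_mono fun ω hω => count_eq_zero.2 fun n hn => hω ⟨n, hn.1⟩
    _ = survival P r (realStretch (massTail P r) η) :=
        h.measure_count_eq_zero (measurableSet_strip hU _ _) (meanMeasure_strip_ne_top _ _ _)
    _ ≤ ε := by
        rw [survival_realStretch hr h1 hη, ← ENNReal.ofReal_coe_nnreal]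
        exact ENNReal.ofReal_le_ofReal hlt.le

variable [IsProbabilityMeasure Pr]

/-- Both sides are probability measures, so domination on every measurable set gives equality. The
domination is the cell estimate with constant cost 1, as δ tends to 0. -/
lemma map_firstIndex (h : IsPoissonProcess 1 P Pr proc) (hr : Measurable r)
    (h1 : ∫⁻ x, r x ∂P = 1) :
    Pr.map (fun ω => (proc ω (firstIndex (acceptRegion P r) (proc ω))).2) =
      P.withDensity fun x => (r x : ℝ≥0∞) := by
  have hU : MeasurableSet (acceptRegion P r) := measurableSet_acceptRegion hr
  have hN : Measurable fun ω => proc ω (firstIndex (acceptRegion P r) (proc ω)) :=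
    measurable_eval_nat h.measurable ((measurable_firstIndex hU).comp h.measurable)
  have : IsProbabilityMeasure (P.withDensity fun x => (r x : ℝ≥0∞)) :=
    ⟨by rw [withDensity_apply _ MeasurableSet.univ, setLIntegral_univ, h1]⟩
  have : IsProbabilityMeasure
      (Pr.map (fun ω => (proc ω (firstIndex (acceptRegion P r) (proc ω))).2)) :=
    Measure.isProbabilityMeasure_map hN.snd.aemeasurable
  refine Measure.eq_of_le_of_isProbabilityMeasure (Measure.le_iff.2 fun B hB => ?_)
  rw [Measure.map_apply hN.snd hB]
  refine le_of_forall_pos_le_exp_mul fun δ hδ => ?_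
  have hA : MeasurableSet (acceptRegion P r ∩ Prod.snd ⁻¹' B) := hU.inter (measurable_snd hB)
  have key := h.lintegral_firstIndex_le hr hA inter_subset_left (L := fun _ => 1)
    (fun _ _ _ => le_rfl) (g := fun _ => 1) measurable_const hδ (fun k t _ => by simp)
  have hm : MeasurableSet {ω | proc ω (firstIndex (acceptRegion P r) (proc ω)) ∈
      acceptRegion P r ∩ Prod.snd ⁻¹' B} := hN hA
  rw [lintegral_indicator_const hm, one_mul] at key
  simp only [mul_one] at key
  calc _ ≤ Pr {ω | proc ω (firstIndex (acceptRegion P r) (proc ω)) ∈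
        acceptRegion P r ∩ Prod.snd ⁻¹' B} := by
        refine measure_mono_ae ?_
        filter_upwards [h.ae_exists_mem_acceptRegion hr h1] with ω hω hB
        exact ⟨Nat.sInf_mem (s := {n | proc ω n ∈ acceptRegion P r}) hω, hB⟩
    _ ≤ ENNReal.ofReal (Real.exp δ) * (P.withDensity (fun x => (r x : ℝ≥0∞)) B) :=
        key.trans (mul_le_mul_right (lintegral_survival_le hr h1 hB) _)
    _ ≤ _ := by gcongr; exact le_self_add

lemma lintegral_log_firstIndex_le (h : IsPoissonProcess 1 P Pr proc) (hr : Measurable r)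
    (h1 : ∫⁻ x, r x ∂P = 1) :
    ∫⁻ ω, ENNReal.ofReal
        (Real.log (1 + (firstIndex (acceptRegion P r) (proc ω) : ℝ))) ∂Pr ≤
      ∫⁻ x, ENNReal.ofReal (InformationTheory.klFun (r x)) ∂P + 2 := by
  classical
  have hU : MeasurableSet (acceptRegion P r) := measurableSet_acceptRegion hr
  refine le_of_forall_pos_le_exp_mul fun δ hδ => ?_
  -- `ENat.toNat` sends `⊤` to 0, so `⊤` is treated apart to keep L monotone.
  let L : ℕ∞ → ℝ≥0∞ := fun c => if c = ⊤ then ⊤ else ENNReal.ofReal (Real.log (1 + c.toNat))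
  have hLn : ∀ n : ℕ, L n = ENNReal.ofReal (Real.log (1 + n)) := fun n => by simp [L]
  have hL : Monotone L := by
    intro a b hab
    induction b using ENat.recTopCoe with
    | top => simp [L]
    | coe b =>
      obtain ⟨a, rfl⟩ := ENat.ne_top_iff_exists.1 (ne_top_of_le_ne_top (ENat.natCast_ne_top b) hab)
      rw [hLn, hLn]
      have : (a : ℝ) ≤ b := by exact_mod_cast hab
      exact ENNReal.ofReal_le_ofReal (Real.log_le_log (by positivity) (by linarith))
  -- The term δ absorbs the mesh: the Poisson mean is at most (k+1)δ ≤ t + δ, and 1 + t + δ ≤ (1 +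
  -- t)(1 + δ).
  let g : ℝ → ℝ≥0∞ := fun t => ENNReal.ofReal (Real.log (1 + t)) + ENNReal.ofReal δ
  have hg : Measurable g := by fun_prop
  have key := h.lintegral_firstIndex_le hr hU subset_rfl hL hg hδ ?_
  · calc _ ≤ ∫⁻ ω, {ω | proc ω (firstIndex (acceptRegion P r) (proc ω)) ∈
          acceptRegion P r}.indicator
          (fun ω => L (firstIndex (acceptRegion P r) (proc ω))) ω ∂Pr := by
          refine lintegral_mono_ae ?_
          filter_upwards [h.ae_exists_mem_acceptRegion hr h1] with ω hω
          have hmem : ω ∈ {ω | proc ω (firstIndex (acceptRegion P r) (proc ω)) ∈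
            acceptRegion P r} := Nat.sInf_mem (s := {n | proc ω n ∈ acceptRegion P r}) hω
          rw [indicator_of_mem hmem, hLn]
      _ ≤ _ := key
      _ ≤ _ := by
          gcongr
          simp only [g, mul_add]
          rw [lintegral_add_right _ (by
            have := (survival_antitone P r).measurable
            fun_prop)]
          refine add_le_add (lintegral_survival_mul_log_le hr h1) ?_
          rw [lintegral_mul_const' _ _ ENNReal.ofReal_ne_top]
          refine mul_le_of_le_one_left' ?_
          have := lintegral_survival_le hr h1 (MeasurableSet.univ)
          rw [preimage_univ, inter_univ, withDensity_apply _ MeasurableSet.univ,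
            setLIntegral_univ, h1] at this
          exact this
  · intro k t ht
    have hk : 0 ≤ (k : ℝ) * δ := by positivity
    have ht0 : 0 < t := hk.trans_lt ht.1
    rw [h.lintegral_count (measurableSet_strip hU.compl _ _) (meanMeasure_strip_ne_top _ _ _)]
    simp only [hLn]
    refine (lintegral_log_poissonMeasure_le _).trans ?_
    have hle := ENNReal.toReal_mono ENNReal.ofReal_ne_top (meanMeasure_strip_le (P := P)
      (acceptRegion P r)ᶜ (s := 0) (t := (k + 1) * δ))
    rw [sub_zero, ENNReal.toReal_ofReal (by positivity)] at hle
    have hlt : 0 ≤ Real.log (1 + t) := Real.log_nonneg (by linarith)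
    simp only [g]
    rw [← ENNReal.ofReal_add hlt hδ.le]
    refine ENNReal.ofReal_le_ofReal ?_
    have hx := ht.1
    have hm : 1 + (meanMeasure 1 P (strip (acceptRegion P r)ᶜ 0 ((k + 1) * δ))).toReal ≤
        (1 + t) * (1 + δ) := by nlinarith
    calc Real.log (1 + (meanMeasure 1 P (strip (acceptRegion P r)ᶜ 0 ((k + 1) * δ))).toReal)
        ≤ Real.log ((1 + t) * (1 + δ)) := Real.log_le_log
          (by have := ENNReal.toReal_nonneg (a := meanMeasure 1 P
                (strip (acceptRegion P r)ᶜ 0 ((k + 1) * δ))); linarith) hm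
      _ = Real.log (1 + t) + Real.log (1 + δ) := Real.log_mul (by positivity) (by positivity)
      _ ≤ Real.log (1 + t) + δ := by
          have := Real.log_le_sub_one_of_pos (show (0 : ℝ) < 1 + δ by positivity)
          linarith

end IsPoissonProcess

lemma accepts_iff (hr : Measurable r) {Q : Measure S} [IsProbabilityMeasure Q]
    (hQ : Q = P.withDensity fun x => (r x : ℝ≥0∞)) (a : ℝ × S) :
    Accepts P Q r a ↔ a ∈ acceptRegion P r := by
  rw [Accepts, stretch_eq_stretchOf hr hQ]
  rfl

lemma index_eq (hr : Measurable r) {Q : Measure S} [IsProbabilityMeasure Q]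
    (hQ : Q = P.withDensity fun x => (r x : ℝ≥0∞)) (p : ℕ → ℝ × S) :
    index P Q r p = firstIndex (acceptRegion P r) p + 1 := by
  simp only [index, accepts_iff hr hQ, firstIndex]

lemma ofReal_logb_two (x : ℝ) :
    ENNReal.ofReal (Real.logb 2 x) = ENNReal.ofReal (Real.log x) / ENNReal.ofReal (Real.log 2) :=
  ENNReal.ofReal_div_of_pos (Real.log_pos one_lt_two)

lemma ofReal_two_mul_logb_exp :
    ENNReal.ofReal (2 * Real.logb 2 (Real.exp 1)) = 2 / ENNReal.ofReal (Real.log 2) := by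
  rw [← ENNReal.ofReal_ofNat 2, ← ENNReal.ofReal_div_of_pos (Real.log_pos one_lt_two)]
  congr 1
  rw [Real.logb, Real.log_exp, mul_one_div]

theorem IsPoissonProcess.gprs [IsProbabilityMeasure Pr] (h : IsPoissonProcess 1 P Pr proc) (hr : Measurable r)
    (Q : Measure S) [IsProbabilityMeasure Q] (hQ : Q = P.withDensity fun x => (r x : ℝ≥0∞)) :
    (∀ᵐ ω ∂Pr, ∃ n, Accepts P Q r (proc ω n)) ∧
      Pr.map (fun ω => decode (proc ω) (index P Q r (proc ω))) = Q ∧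
      ∫⁻ ω, ENNReal.ofReal (Real.logb 2 (index P Q r (proc ω))) ∂Pr ≤
        klBits Q P + ENNReal.ofReal (2 * Real.logb 2 (Real.exp 1)) := by
  have h1 := lintegral_density Q hQ
  refine ⟨?_, ?_, ?_⟩
  · simp only [accepts_iff hr hQ]
    exact h.ae_exists_mem_acceptRegion hr h1
  · simp only [index_eq hr hQ, decode, Nat.add_sub_cancel]
    rw [h.map_firstIndex hr h1, hQ]
  · have hfin : IsFiniteMeasure (P.withDensity fun x => (r x : ℝ≥0∞)) := hQ ▸ inferInstance
    rw [klBits, hQ, klDiv_withDensity hr, ofReal_two_mul_logb_exp, ENNReal.div_add_div_same]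
    simp only [ofReal_logb_two, div_eq_mul_inv]
    rw [lintegral_mul_const']
    · gcongr
      refine le_of_eq_of_le ?_ (h.lintegral_log_firstIndex_le hr h1)
      simp only [← hQ, index_eq hr hQ]
      push_cast
      simp only [add_comm]
    · simpa using Real.log_pos one_lt_two

end GPRS

namespace GPRS

open Set Filter Topology

/-! ### Entropy and codelengths -/

/-- The integral test in telescoping form: with a = n + 1, (a+1)^(−1−ε) ≤ (a^(−ε) − (a+1)^(−ε))/ε.
-/
lemma sum_range_rpow_le {ε : ℝ} (hε : 0 < ε) (n : ℕ) :
    ∑ i ∈ Finset.range (n + 1), ((i : ℝ) + 1) ^ (-(1 + ε)) ≤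
      1 + 1 / ε - ((n : ℝ) + 1) ^ (-ε) / ε := by
  induction n with
  | zero => simp
  | succ n ih =>
    rw [Finset.sum_range_succ]
    push_cast
    have ha : (0 : ℝ) < (n : ℝ) + 1 := by positivity
    set a : ℝ := (n : ℝ) + 1 with hadef
    have hb : 0 < a + 1 := by positivity
    have h1 : (a + 1) ^ (-ε) * (1 + ε / (a + 1)) ≤ a ^ (-ε) := by
      have h2 : a ^ (-ε) = (a + 1) ^ (-ε) * (a / (a + 1)) ^ (-ε) := by
        rw [Real.div_rpow ha.le hb.le, mul_div_cancel₀ _ (by positivity)]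
      rw [h2]
      gcongr
      have h3 : Real.log (a / (a + 1)) ≤ -(1 / (a + 1)) := by
        refine (Real.log_le_sub_one_of_pos (by positivity)).trans_eq ?_
        field_simp; ring
      rw [Real.rpow_def_of_pos (by positivity)]
      have h4 := Real.add_one_le_exp (Real.log (a / (a + 1)) * -ε)
      have h5 : ε / (a + 1) ≤ Real.log (a / (a + 1)) * -ε := by
        have := mul_le_mul_of_nonneg_right h3 hε.le
        rw [neg_mul, one_div_mul_eq_div] at this
        linarith
      linarith
    have h6 : (a + 1) ^ (-(1 + ε)) = (a + 1) ^ (-ε) / (a + 1) := by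
      rw [show -(1 + ε) = -ε - 1 by ring, Real.rpow_sub_one hb.ne']
    have h7 : (a + 1) ^ (-(1 + ε)) ≤ a ^ (-ε) / ε - (a + 1) ^ (-ε) / ε := by
      rw [h6, ← sub_div, le_div_iff₀ hε]
      have : (a + 1) ^ (-ε) / (a + 1) * ε = (a + 1) ^ (-ε) * (ε / (a + 1)) := by ring
      rw [this]
      linarith
    linarith

/-- The length in nats of a code for the nonnegative integers with a power law. -/
noncomputable def powerCode (ε : ℝ) (n : ℕ) : ℝ :=
  (1 + ε) * Real.log (1 + n) + Real.log (1 + 1 / ε)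

lemma powerCode_nonneg {ε : ℝ} (hε : 0 < ε) (n : ℕ) : 0 ≤ powerCode ε n := by
  have h1 : 0 ≤ Real.log (1 + (n : ℝ)) := Real.log_nonneg (by simp)
  have h2 : 0 ≤ Real.log (1 + 1 / ε) := Real.log_nonneg (by simp [hε.le])
  unfold powerCode
  positivity

lemma powerCode_mono {ε : ℝ} (hε : 0 < ε) : Monotone (powerCode ε) := by
  intro a b hab
  unfold powerCode
  gcongr

/-- Kraft's inequality: the constant term of the code normalises by 1 + 1/ε ≥ ζ(1 + ε). -/
lemma tsum_exp_neg_powerCode_le {ε : ℝ} (hε : 0 < ε) :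
    ∑' n, ENNReal.ofReal (Real.exp (-powerCode ε n)) ≤ 1 := by
  refine ENNReal.tsum_le_of_sum_range_le fun n => ?_
  rw [← ENNReal.ofReal_sum_of_nonneg fun _ _ => (Real.exp_pos _).le, ← ENNReal.ofReal_one]
  refine ENNReal.ofReal_le_ofReal ?_
  have h1 : ∀ i : ℕ, Real.exp (-powerCode ε i) =
      ((i : ℝ) + 1) ^ (-(1 + ε)) / (1 + 1 / ε) := by
    intro i
    have hc : 0 < 1 + 1 / ε := by positivity
    rw [powerCode, neg_add, Real.exp_add, Real.exp_neg (Real.log (1 + 1 / ε)), Real.exp_log hc,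
      Real.rpow_def_of_pos (by positivity), div_eq_mul_inv, add_comm (i : ℝ) 1]
    congr 2
    ring
  simp only [h1]
  rw [← Finset.sum_div, div_le_one (by positivity)]
  refine (Finset.sum_le_sum_of_subset_of_nonneg (Finset.range_subset_range.2 n.le_succ)
    fun i _ _ => by positivity).trans ((sum_range_rpow_le hε n).trans ?_)
  have : 0 ≤ ((n : ℝ) + 1) ^ (-ε) / ε := by positivity
  linarith

/-- The pointwise Gibbs inequality: log z ≤ z − 1 at z = e^(−c)/m, multiplied by m. -/
lemma negMulLog_add_le {m c : ℝ} (hm : 0 ≤ m) :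
    Real.negMulLog m + m ≤ c * m + Real.exp (-c) := by
  rcases hm.eq_or_lt with rfl | h0
  · simpa using (Real.exp_pos _).le
  · have h := Real.log_le_sub_one_of_pos (show 0 < Real.exp (-c) / m by positivity)
    rw [Real.log_div (Real.exp_pos _).ne' h0.ne', Real.log_exp] at h
    have h2 := mul_le_mul_of_nonneg_left h hm
    rw [mul_sub, mul_sub, mul_div_cancel₀ _ h0.ne'] at h2
    rw [Real.negMulLog]
    linarith

variable {S : Type*} [MeasurableSpace S]

/-- The entropy of a function of `M` is at most the mean length of a prefix code for `M`. -/
lemma entropyBits_map_le [MeasurableSingletonClass S] {α : Type*} [MeasurableSpace α]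
    (ν : Measure α) [IsProbabilityMeasure ν] {M : α → ℕ} (hM : Measurable M) (g : ℕ → S)
    {c : ℕ → ℝ} (hc0 : ∀ n, 0 ≤ c n) (hc : Monotone c)
    (hsum : ∑' n, ENNReal.ofReal (Real.exp (-c n)) ≤ 1) :
    entropyBits (ν.map fun a => g (M a)) ≤
      (∫⁻ a, ENNReal.ofReal (c (M a)) ∂ν) / ENNReal.ofReal (Real.log 2) := by
  have hgM : Measurable fun a => g (M a) := (Measurable.of_discrete (f := g)).comp hM
  set μ := ν.map fun a => g (M a) with hμ
  have : IsProbabilityMeasure μ := Measure.isProbabilityMeasure_map hgM.aemeasurable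
  have hs : (range g).Countable := countable_range g
  have hμs : μ (range g)ᶜ = 0 := by
    rw [hμ, Measure.map_apply hgM hs.measurableSet.compl]
    have : (fun a => g (M a)) ⁻¹' (range g)ᶜ = ∅ := by
      ext a; simp
    rw [this, measure_empty]
  have hμ1 : μ (range g) = 1 := (prob_compl_eq_zero_iff hs.measurableSet).1 hμs
  -- As g need not be injective, each value is coded by its least index. This is injective on the
  -- range and, c being monotone, costs at most c(M).
  let idx : S → ℕ := fun x => sInf {n | g n = x}
  have hidx : ∀ x ∈ range g, g (idx x) = x := fun x hx => Nat.sInf_mem (s := {n | g n = x}) hx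
  have hidx_le : ∀ n, idx (g n) ≤ n := fun n => Nat.sInf_le rfl
  rw [entropyBits, if_pos ⟨range g, hs, hμs⟩]
  simp only [ENNReal.ofReal_div_of_pos (Real.log_pos one_lt_two)]
  simp only [div_eq_mul_inv]
  rw [ENNReal.tsum_mul_right]
  gcongr
  have hsupp : ∑' x, ENNReal.ofReal (Real.negMulLog (μ.real {x})) =
      ∑' x : range g, ENNReal.ofReal (Real.negMulLog (μ.real {(x : S)})) := by
    refine (tsum_subtype_eq_of_support_subset fun x hx => ?_).symm
    by_contra hxg
    have : μ {x} = 0 := measure_mono_null (singleton_subset_iff.2 hxg) hμs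
    simp [measureReal_def, this] at hx
  rw [hsupp]
  have hone : ∑' x : range g, ENNReal.ofReal (μ.real {(x : S)}) = 1 := by
    have := lintegral_countable (μ := μ) (fun _ => 1) hs
    rw [setLIntegral_one, hμ1] at this
    simpa using this.symm
  -- Summed, the additions are the total mass 1 on the left and a Kraft sum at most 1 on the right,
  -- so they drop out.
  have hpt : ∑' x : range g, (ENNReal.ofReal (Real.negMulLog (μ.real {(x : S)})) +
      ENNReal.ofReal (μ.real {(x : S)})) ≤
      ∑' x : range g, (ENNReal.ofReal (c (idx x)) * μ {(x : S)} +
        ENNReal.ofReal (Real.exp (-c (idx x)))) := by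
    refine ENNReal.tsum_le_tsum fun x => ?_
    have hm1 : μ.real {(x : S)} ≤ 1 := measureReal_le_one
    rw [← ENNReal.ofReal_add (Real.negMulLog_nonneg measureReal_nonneg hm1) measureReal_nonneg,
      ← ofReal_measureReal (μ := μ) (s := {(x : S)}), ← ENNReal.ofReal_mul (hc0 _),
      ← ENNReal.ofReal_add (mul_nonneg (hc0 _) measureReal_nonneg) (Real.exp_pos _).le]
    exact ENNReal.ofReal_le_ofReal (negMulLog_add_le measureReal_nonneg)
  rw [ENNReal.tsum_add, ENNReal.tsum_add, hone,
    ← lintegral_countable (μ := μ) (fun x => ENNReal.ofReal (c (idx x))) hs] at hpt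
  have hinj : Function.Injective fun x : range g => idx x := fun x y hxy => by
    have h1 := hidx x x.2
    have h2 := hidx y y.2
    simp only at hxy
    rw [hxy] at h1
    exact Subtype.ext (h1.symm.trans h2)
  have hq : ∑' x : range g, ENNReal.ofReal (Real.exp (-c (idx x))) ≤ 1 :=
    (ENNReal.tsum_comp_le_tsum_of_injective hinj
      fun n => ENNReal.ofReal (Real.exp (-c n))).trans hsum
  have hfin := (ENNReal.add_le_add_iff_right ENNReal.one_ne_top).1
    (hpt.trans (add_le_add_right hq _))
  refine hfin.trans ((setLIntegral_le_lintegral _ _).trans ((lintegral_map_le _ _).trans ?_))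
  exact lintegral_mono fun a => ENNReal.ofReal_le_ofReal (hc (hidx_le (M a)))

/-! ### Joint measurability in the target -/

variable {Y : Type*} [MeasurableSpace Y] {P : Measure S} [IsProbabilityMeasure P]
  {r : Y → S → ℝ≥0}

/-- The target varies with the input, so the acceptance region must be measurable jointly in both.
-/
lemma measurable_excess_massTail (hr : Measurable (Function.uncurry r)) :
    Measurable fun q : Y × ℝ => excess (massTail P (r q.1)) q.2 := by
  have hm : Measurable fun q : Y × ℝ => massTail P (r q.1) q.2 := by
    have hset : MeasurableSet {z : (Y × ℝ) × S | z.1.2 ≤ (r z.1.1 z.2 : ℝ)} := by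
      refine measurableSet_le (by fun_prop) (measurable_coe_nnreal_real.comp ?_)
      exact hr.comp (measurable_fst.fst.prodMk measurable_snd)
    exact (measurable_measure_prodMk_left hset).ennreal_toReal
  have hset : MeasurableSet {z : (Y × ℝ) × ℝ | z.1.2 < z.2} :=
    measurableSet_lt (by fun_prop) (by fun_prop)
  have hf : Measurable fun z : (Y × ℝ) × ℝ =>
      {z : (Y × ℝ) × ℝ | z.1.2 < z.2}.indicator (fun z => massTail P (r z.1.1) z.2) z :=
    (hm.comp (measurable_fst.fst.prodMk measurable_snd)).indicator hset
  convert (hf.stronglyMeasurable.integral_prod_right' (ν := volume)).measurable using 2 with q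
  rw [excess, ← integral_indicator measurableSet_Ioi]
  rfl

lemma measurable_stretchOf_massTail (hr : Measurable (Function.uncurry r)) :
    Measurable fun q : Y × ℝ => stretchOf (massTail P (r q.1)) q.2 := by
  have hset : MeasurableSet {z : (Y × ℝ) × ℝ | z.2 ∈ Ioc 0 z.1.2} :=
    (measurableSet_lt (measurable_const (a := (0 : ℝ))) measurable_snd).inter
      (measurableSet_le measurable_snd measurable_fst.snd)
  have hf : Measurable fun z : (Y × ℝ) × ℝ => {z : (Y × ℝ) × ℝ | z.2 ∈ Ioc 0 z.1.2}.indicator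
      (fun z => (ENNReal.ofReal (excess (massTail P (r z.1.1)) z.2))⁻¹) z :=
    ((measurable_excess_massTail hr).comp
      (measurable_fst.fst.prodMk measurable_snd)).ennreal_ofReal.inv.indicator hset
  convert hf.lintegral_prod_right' (ν := volume) using 2 with q
  rw [stretchOf, ← lintegral_indicator measurableSet_Ioc]
  rfl

lemma measurableSet_setOf_mem_acceptRegion (hr : Measurable (Function.uncurry r)) :
    MeasurableSet {q : Y × (ℝ × S) | q.2 ∈ acceptRegion P (r q.1)} := by
  refine measurableSet_lt measurable_snd.fst.ennreal_ofReal ?_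
  refine (measurable_stretchOf_massTail hr).comp
    (g := fun q : Y × ℝ => stretchOf (massTail P (r q.1)) q.2)
    (f := fun q : Y × (ℝ × S) => (q.1, ((r q.1 q.2.2 : ℝ≥0) : ℝ))) ?_
  exact measurable_fst.prodMk (measurable_coe_nnreal_real.comp
    (hr.comp (measurable_fst.prodMk measurable_snd.snd)))

lemma measurable_firstIndex_acceptRegion (hr : Measurable (Function.uncurry r)) :
    Measurable fun q : Y × (ℕ → ℝ × S) => firstIndex (acceptRegion P (r q.1)) q.2 :=
  measurable_sInf_setOf (E := fun n => {q : Y × (ℕ → ℝ × S) | q.2 n ∈ acceptRegion P (r q.1)})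
    fun n => measurableSet_setOf_mem_acceptRegion hr |>.preimage
      (f := fun q : Y × (ℕ → ℝ × S) => (q.1, q.2 n))
      (measurable_fst.prodMk ((measurable_pi_apply n).comp measurable_snd))

end GPRS

namespace GPRS

open Set Filter Topology

/-! ### The channel simulation protocol -/

/-- The codelength in bits of a power-law code, tuned to a mean log-index of `(J + 2) / log 2`. -/
lemma exists_powerCode_bound {J : ℝ} (hJ : 0 ≤ J) :
    ∃ ε : ℝ, 0 < ε ∧ ((1 + ε) * (J + 2) + Real.log (1 + 1 / ε)) / Real.log 2 ≤
      J / Real.log 2 + Real.logb 2 (J / Real.log 2 + 1) + 6 := by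
  have hl : 0 < Real.log 2 := Real.log_pos one_lt_two
  set I := J / Real.log 2 with hI
  have hI0 : 0 ≤ I := by positivity
  have hJI : J = I * Real.log 2 := by rw [hI]; field_simp
  have h23 : (2 : ℝ) ≤ 3 * Real.log 2 := by linarith [Real.log_two_gt_d9]
  -- As J + 2 ≤ (I + 3) log 2, this choice bounds the first term by (I + 4) log 2. The second is
  -- log(I + 4) ≤ log(I + 1) + 2 log 2, and 4 + 2 = 6.
  refine ⟨1 / (I + 3), by positivity, ?_⟩
  rw [one_div_one_div, div_le_iff₀ hl, add_mul (_ + _) (6 : ℝ), add_mul I, ← hJI, Real.logb, div_mul_cancel₀ _ hl.ne']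
  have h1 : (1 + 1 / (I + 3)) * (J + 2) ≤ (I + 4) * Real.log 2 := by
    calc (1 + 1 / (I + 3)) * (J + 2) ≤ (1 + 1 / (I + 3)) * ((I + 3) * Real.log 2) := by
          gcongr
          rw [hJI]; linarith
      _ = (I + 4) * Real.log 2 := by field_simp; ring
  have h2 : Real.log (1 + (I + 3)) ≤ Real.log (I + 1) + 2 * Real.log 2 := by
    have : Real.log (I + 1) + 2 * Real.log 2 = Real.log ((I + 1) * 4) := by
      rw [Real.log_mul (by positivity) (by norm_num), show (4 : ℝ) = 2 ^ 2 by norm_num,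
        Real.log_pow]
      push_cast; ring
    rw [this]
    exact Real.log_le_log (by positivity) (by linarith)
  rw [add_mul I, ← hJI] at h1
  linarith

variable {S Y Ω : Type*} [MeasurableSpace S] [MeasurableSpace Y] [MeasurableSpace Ω]

/-- The spatial coordinate of the first accepted arrival, as a function of the target and of the
arrivals. -/
noncomputable def accepted (P : Measure S) (r : Y → S → ℝ≥0) (q : Y × (ℕ → ℝ × S)) : S :=
  (q.2 (firstIndex (acceptRegion P (r q.1)) q.2)).2

lemma measurable_accepted {P : Measure S} [IsProbabilityMeasure P] {r : Y → S → ℝ≥0}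
    (hr : Measurable (Function.uncurry r)) : Measurable (accepted P r) :=
  (measurable_eval_nat measurable_snd (measurable_firstIndex_acceptRegion hr)).snd

/-- The conditional law of the output, given the arrivals. -/
noncomputable def outputKernel (P : Measure S) [IsProbabilityMeasure P] (μ : Measure Y)
    [IsProbabilityMeasure μ] (r : Y → S → ℝ≥0) (hr : Measurable (Function.uncurry r)) :
    Kernel (ℕ → ℝ × S) S where
  toFun p := μ.map fun v => accepted P r (v, p)
  measurable' := by
    refine Measure.measurable_of_measurable_coe _ fun s hs => ?_
    have : (fun p => μ.map (fun v => accepted P r (v, p)) s) =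
        fun p => μ ((fun v => (v, p)) ⁻¹' (accepted P r ⁻¹' s)) := by
      ext p
      exact Measure.map_apply ((measurable_accepted hr).comp measurable_prodMk_right) hs
    rw [this]
    exact measurable_measure_prodMk_right (measurable_accepted hr hs)

instance (P : Measure S) [IsProbabilityMeasure P] (μ : Measure Y)
    [IsProbabilityMeasure μ] (r : Y → S → ℝ≥0) (hr : Measurable (Function.uncurry r)) :
    IsMarkovKernel (outputKernel P μ r hr) :=
  ⟨fun _ => Measure.isProbabilityMeasure_map
    ((measurable_accepted hr).comp measurable_prodMk_right).aemeasurable⟩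

/-- Under the product law the arrivals can be held fixed while the input is integrated out. This
identifies `outputKernel` as a conditional law of the output. -/
lemma map_accepted_eq_compProd {P : Measure S} [IsProbabilityMeasure P] (μ : Measure Y)
    [IsProbabilityMeasure μ] {r : Y → S → ℝ≥0} (hr : Measurable (Function.uncurry r))
    (ν : Measure (ℕ → ℝ × S)) [IsProbabilityMeasure ν] :
    (μ.prod ν).map (fun q => (q.2, accepted P r q)) = ν ⊗ₘ outputKernel P μ r hr := by
  have hG := measurable_accepted (P := P) hr
  ext s hs
  have hm : Measurable fun q : Y × (ℕ → ℝ × S) => (q.2, accepted P r q) := measurable_snd.prodMk hG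
  rw [Measure.map_apply hm hs, Measure.prod_apply_symm (hm hs), Measure.compProd_apply hs]
  refine lintegral_congr fun p => ?_
  change _ = μ.map (fun v => accepted P r (v, p)) (Prod.mk p ⁻¹' s)
  exact (Measure.map_apply (hG.comp measurable_prodMk_right) (measurable_prodMk_left hs)).symm

lemma entropyBits_outputKernel_le [MeasurableSingletonClass S] {P : Measure S}
    [IsProbabilityMeasure P] (μ : Measure Y)
    [IsProbabilityMeasure μ] {r : Y → S → ℝ≥0} (hr : Measurable (Function.uncurry r))
    {ε : ℝ} (hε : 0 < ε) (p : ℕ → ℝ × S) :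
    entropyBits (outputKernel P μ r hr p) ≤
      (∫⁻ v, ENNReal.ofReal (powerCode ε (firstIndex (acceptRegion P (r v)) p)) ∂μ) /
        ENNReal.ofReal (Real.log 2) :=
  entropyBits_map_le μ ((measurable_firstIndex_acceptRegion hr).comp measurable_prodMk_right)
    (fun n => (p n).2) (powerCode_nonneg hε) (powerCode_mono hε) (tsum_exp_neg_powerCode_le hε)

lemma ofReal_powerCode {ε : ℝ} (hε : 0 < ε) (n : ℕ) :
    ENNReal.ofReal (powerCode ε n) = ENNReal.ofReal (1 + ε) * ENNReal.ofReal (Real.log (1 + n)) +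
      ENNReal.ofReal (Real.log (1 + 1 / ε)) := by
  have h1 : 0 ≤ Real.log (1 + (n : ℝ)) := Real.log_nonneg (by simp)
  rw [← ENNReal.ofReal_mul (by positivity), ← ENNReal.ofReal_add (by positivity)
    (Real.log_nonneg (by simp [hε.le])), powerCode]

/-- Disintegration turns the conditional densities into a joint density, so the mutual information
becomes an average of divergences. -/
lemma eq_withDensity_prod [StandardBorelSpace S] [Nonempty S] (ρ : Measure (Y × S))
    [IsProbabilityMeasure ρ]
    {r : Y → S → ℝ≥0} (hr : Measurable (Function.uncurry r))
    (hρ : ∀ᵐ v ∂ρ.fst, ρ.condKernel v = ρ.snd.withDensity (fun u => (r v u : ℝ≥0∞))) :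
    ρ = (ρ.fst.prod ρ.snd).withDensity fun z => ((Function.uncurry r z : ℝ≥0) : ℝ≥0∞) := by
  ext s hs
  have h : ρ s = (ρ.fst ⊗ₘ ρ.condKernel) s := by rw [Measure.disintegrate]
  rw [h, Measure.compProd_apply hs, withDensity_apply _ hs, ← lintegral_indicator hs,
    lintegral_prod _ (hr.coe_nnreal_ennreal.indicator hs).aemeasurable]
  refine lintegral_congr_ae ?_
  filter_upwards [hρ] with v hv
  rw [hv, withDensity_apply _ (measurable_prodMk_left hs),
    ← lintegral_indicator (measurable_prodMk_left hs)]
  rfl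

lemma klDiv_fst_prod_snd [StandardBorelSpace S] [Nonempty S] (ρ : Measure (Y × S))
    [IsProbabilityMeasure ρ]
    {r : Y → S → ℝ≥0} (hr : Measurable (Function.uncurry r))
    (hρ : ∀ᵐ v ∂ρ.fst, ρ.condKernel v = ρ.snd.withDensity (fun u => (r v u : ℝ≥0∞))) :
    InformationTheory.klDiv ρ (ρ.fst.prod ρ.snd) =
      ∫⁻ v, ∫⁻ u, ENNReal.ofReal (InformationTheory.klFun (r v u)) ∂ρ.snd ∂ρ.fst := by
  have h := eq_withDensity_prod ρ hr hρ
  have hfin : IsFiniteMeasure ((ρ.fst.prod ρ.snd).withDensity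
      fun z => ((Function.uncurry r z : ℝ≥0) : ℝ≥0∞)) := h ▸ inferInstance
  have hk := klDiv_withDensity (P := ρ.fst.prod ρ.snd) hr
  rw [← h] at hk
  rw [hk, lintegral_prod]
  · rfl
  · exact (InformationTheory.measurable_klFun.comp
      (measurable_coe_nnreal_real.comp hr)).ennreal_ofReal.aemeasurable

/-! ### The protocol under the product law of input and arrivals -/

section Protocol

variable [StandardBorelSpace S] [Nonempty S] {ρ : Measure (Y × S)} [IsProbabilityMeasure ρ]
  {r : Y → S → ℝ≥0} {Pr : Measure Ω} [IsProbabilityMeasure Pr] {proc : Ω → ℕ → ℝ × S}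

lemma ae_ae_exists_mem (hr : Measurable (Function.uncurry r))
    (hρ : ∀ᵐ v ∂ρ.fst, ρ.condKernel v = ρ.snd.withDensity (fun u => (r v u : ℝ≥0∞)))
    (hproc : IsPoissonProcess 1 ρ.snd Pr proc) :
    ∀ᵐ q ∂ρ.fst.prod (Pr.map proc), ∃ n, q.2 n ∈ acceptRegion ρ.snd (r q.1) := by
  have hm : MeasurableSet {q : Y × (ℕ → ℝ × S) | ∃ n, q.2 n ∈ acceptRegion ρ.snd (r q.1)} := by
    have : {q : Y × (ℕ → ℝ × S) | ∃ n, q.2 n ∈ acceptRegion ρ.snd (r q.1)} =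
        ⋃ n, (fun q : Y × (ℕ → ℝ × S) => (q.1, q.2 n)) ⁻¹'
          {q | q.2 ∈ acceptRegion ρ.snd (r q.1)} := by
      ext q; simp
    rw [this]
    exact MeasurableSet.iUnion fun n => (measurable_fst.prodMk
      ((measurable_pi_apply n).comp measurable_snd)) (measurableSet_setOf_mem_acceptRegion hr)
  have := Measure.isProbabilityMeasure_map (μ := Pr) hproc.measurable.aemeasurable
  refine (Measure.ae_prod_iff_ae_ae hm).2 ?_
  filter_upwards [hρ] with v hv
  have hrv : Measurable (r v) := hr.comp measurable_prodMk_left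
  have hmv : MeasurableSet {p : ℕ → ℝ × S | ∃ n, p n ∈ acceptRegion ρ.snd (r v)} :=
    measurable_prodMk_left hm
  rw [ae_map_iff hproc.measurable.aemeasurable hmv]
  exact hproc.ae_exists_mem_acceptRegion hrv (lintegral_density _ hv)

lemma map_accepted_eq (hr : Measurable (Function.uncurry r))
    (hρ : ∀ᵐ v ∂ρ.fst, ρ.condKernel v = ρ.snd.withDensity (fun u => (r v u : ℝ≥0∞)))
    (hproc : IsPoissonProcess 1 ρ.snd Pr proc) :
    (ρ.fst.prod (Pr.map proc)).map (fun q => (q.1, accepted ρ.snd r q)) = ρ := by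
  have hG := measurable_accepted (P := ρ.snd) hr
  have hm : Measurable fun q : Y × (ℕ → ℝ × S) => (q.1, accepted ρ.snd r q) :=
    measurable_fst.prodMk hG
  have := Measure.isProbabilityMeasure_map (μ := Pr) hproc.measurable.aemeasurable
  ext s hs
  have h : ρ s = (ρ.fst ⊗ₘ ρ.condKernel) s := by rw [Measure.disintegrate]
  rw [h, Measure.compProd_apply hs, Measure.map_apply hm hs, Measure.prod_apply (hm hs)]
  refine lintegral_congr_ae ?_
  filter_upwards [hρ] with v hv
  have hrv : Measurable (r v) := hr.comp measurable_prodMk_left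
  have hGv : Measurable fun ω => (proc ω (firstIndex (acceptRegion ρ.snd (r v)) (proc ω))).2 :=
    (hG.comp measurable_prodMk_left).comp hproc.measurable
  rw [hv, ← hproc.map_firstIndex hrv (lintegral_density _ hv),
    Measure.map_apply hproc.measurable (measurable_prodMk_left (hm hs)),
    Measure.map_apply hGv (measurable_prodMk_left hs)]
  rfl

lemma lintegral_lintegral_log_le (hr : Measurable (Function.uncurry r))
    (hρ : ∀ᵐ v ∂ρ.fst, ρ.condKernel v = ρ.snd.withDensity (fun u => (r v u : ℝ≥0∞)))
    (hproc : IsPoissonProcess 1 ρ.snd Pr proc) :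
    ∫⁻ q, ENNReal.ofReal (Real.log (1 + (firstIndex (acceptRegion ρ.snd (r q.1)) q.2 : ℝ)))
      ∂(ρ.fst.prod (Pr.map proc)) ≤ InformationTheory.klDiv ρ (ρ.fst.prod ρ.snd) + 2 := by
  have hm : Measurable fun q : Y × (ℕ → ℝ × S) => ENNReal.ofReal
      (Real.log (1 + (firstIndex (acceptRegion ρ.snd (r q.1)) q.2 : ℝ))) :=
    (Measurable.of_discrete (f := fun n : ℕ => ENNReal.ofReal (Real.log (1 + (n : ℝ))))).comp
      (measurable_firstIndex_acceptRegion hr)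
  have := Measure.isProbabilityMeasure_map (μ := Pr) hproc.measurable.aemeasurable
  rw [lintegral_prod _ hm.aemeasurable, klDiv_fst_prod_snd ρ hr hρ]
  calc ∫⁻ v, ∫⁻ p, ENNReal.ofReal (Real.log (1 + (firstIndex (acceptRegion ρ.snd (r v)) p : ℝ)))
          ∂(Pr.map proc) ∂ρ.fst
      ≤ ∫⁻ v, (∫⁻ u, ENNReal.ofReal (InformationTheory.klFun (r v u)) ∂ρ.snd + 2) ∂ρ.fst := by
        refine lintegral_mono_ae ?_
        filter_upwards [hρ] with v hv
        have hrv : Measurable (r v) := hr.comp measurable_prodMk_left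
        have hmv : Measurable fun p : ℕ → ℝ × S => ENNReal.ofReal
            (Real.log (1 + (firstIndex (acceptRegion ρ.snd (r v)) p : ℝ))) :=
          (Measurable.of_discrete (f := fun n : ℕ => ENNReal.ofReal (Real.log (1 + (n : ℝ))))).comp
            (measurable_firstIndex (measurableSet_acceptRegion hrv))
        rw [lintegral_map hmv hproc.measurable]
        exact hproc.lintegral_log_firstIndex_le hrv (lintegral_density _ hv)
    _ = ∫⁻ v, ∫⁻ u, ENNReal.ofReal (InformationTheory.klFun (r v u)) ∂ρ.snd ∂ρ.fst + 2 := by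
        rw [lintegral_add_right _ measurable_const, lintegral_const, measure_univ, mul_one]

/-- The codelength is affine in the log-index, so after averaging over input and arrivals only the
mean log-index, at most J + 2 nats, enters. -/
lemma lintegral_entropyBits_outputKernel_le (hr : Measurable (Function.uncurry r))
    (hρ : ∀ᵐ v ∂ρ.fst, ρ.condKernel v = ρ.snd.withDensity (fun u => (r v u : ℝ≥0∞)))
    (hproc : IsPoissonProcess 1 ρ.snd Pr proc) (hI : mutualInfoBits ρ ≠ ∞) :
    ∫⁻ p, entropyBits (outputKernel ρ.snd ρ.fst r hr p) ∂(Pr.map proc) ≤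
      ENNReal.ofReal ((mutualInfoBits ρ).toReal +
        Real.logb 2 ((mutualInfoBits ρ).toReal + 1) + 6) := by
  have hl : 0 < Real.log 2 := Real.log_pos one_lt_two
  have := Measure.isProbabilityMeasure_map (μ := Pr) hproc.measurable.aemeasurable
  set K := InformationTheory.klDiv ρ (ρ.fst.prod ρ.snd) with hK
  have hKtop : K ≠ ∞ := by
    rintro h
    rw [mutualInfoBits, klBits, ← hK, h, ENNReal.top_div_of_ne_top ENNReal.ofReal_ne_top] at hI
    exact hI rfl
  have hIJ : (mutualInfoBits ρ).toReal = K.toReal / Real.log 2 := by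
    rw [mutualInfoBits, klBits, ENNReal.toReal_div, ENNReal.toReal_ofReal hl.le]
  have hJ : 0 ≤ K.toReal := ENNReal.toReal_nonneg
  obtain ⟨ε, hε, hbound⟩ := exists_powerCode_bound hJ
  have hm : Measurable fun q : Y × (ℕ → ℝ × S) => ENNReal.ofReal
      (powerCode ε (firstIndex (acceptRegion ρ.snd (r q.1)) q.2)) :=
    (Measurable.of_discrete (f := fun n : ℕ => ENNReal.ofReal (powerCode ε n))).comp
      (measurable_firstIndex_acceptRegion hr)
  have hlog : 0 ≤ Real.log (1 + 1 / ε) := Real.log_nonneg (by simp [hε.le])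
  rw [hIJ]
  calc _ ≤ ∫⁻ p, (∫⁻ v, ENNReal.ofReal
          (powerCode ε (firstIndex (acceptRegion ρ.snd (r v)) p)) ∂ρ.fst) /
          ENNReal.ofReal (Real.log 2) ∂(Pr.map proc) :=
        lintegral_mono fun p => entropyBits_outputKernel_le ρ.fst hr hε p
    _ = (∫⁻ q, ENNReal.ofReal (powerCode ε (firstIndex (acceptRegion ρ.snd (r q.1)) q.2))
          ∂(ρ.fst.prod (Pr.map proc))) / ENNReal.ofReal (Real.log 2) := by
        simp only [div_eq_mul_inv]
        rw [lintegral_mul_const' _ _ (by simpa using hl), lintegral_prod_symm _ hm.aemeasurable]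
    _ ≤ (ENNReal.ofReal (1 + ε) * (K + 2) + ENNReal.ofReal (Real.log (1 + 1 / ε))) /
          ENNReal.ofReal (Real.log 2) := by
        gcongr
        simp only [ofReal_powerCode hε]
        rw [lintegral_add_right _ measurable_const, lintegral_const_mul' _ _ ENNReal.ofReal_ne_top,
          lintegral_const, measure_univ, mul_one]
        gcongr
        exact lintegral_lintegral_log_le hr hρ hproc
    _ = ENNReal.ofReal (((1 + ε) * (K.toReal + 2) + Real.log (1 + 1 / ε)) / Real.log 2) := by
        rw [ENNReal.ofReal_div_of_pos hl, ENNReal.ofReal_add (by positivity) hlog,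
          ENNReal.ofReal_mul (by positivity), ENNReal.ofReal_add hJ zero_le_two,
          ENNReal.ofReal_toReal hKtop, ENNReal.ofReal_ofNat]
    _ ≤ _ := ENNReal.ofReal_le_ofReal hbound

end Protocol

end GPRS

/-- The joint law of `(y, x)` is `ρ`, so that `P_y = ρ.fst`, `P_x = ρ.snd` and
`P_{x | y = v} = ρ.condKernel v`; `r v` is the density ratio `dP_{x | y = v} / dP_x`. -/
theorem mainTheorem4 {S Y Ω : Type*} [MeasurableSpace S] [StandardBorelSpace S] [Nonempty S]
    [MeasurableSpace Y] [MeasurableSpace Ω]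
    (ρ : Measure (Y × S)) [IsProbabilityMeasure ρ]
    (r : Y → S → ℝ≥0) (hr : Measurable (Function.uncurry r))
    (hρ : ∀ᵐ v ∂ρ.fst, ρ.condKernel v = ρ.snd.withDensity (fun u => (r v u : ℝ≥0∞)))
    (Pr : Measure Ω) [IsProbabilityMeasure Pr]
    (y : Ω → Y) (hy : Measurable y) (hlaw : Pr.map y = ρ.fst)
    (proc : Ω → ℕ → ℝ × S) (hproc : GPRS.IsPoissonProcess 1 ρ.snd Pr proc)
    (hind : IndepFun y proc Pr)
    (N : Ω → ℕ)
    (hN : ∀ ω, N ω = GPRS.index ρ.snd (ρ.condKernel (y ω)) (r (y ω)) (proc ω))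
    (x : Ω → S) (hx : ∀ ω, x ω = GPRS.decode (proc ω) (N ω)) :
    -- the sampler with proposal `P_x` and an arbitrary fixed target `Q`: almost sure termination,
    -- correctness, and the one-shot bound
    (∀ (Q : Measure S) [IsProbabilityMeasure Q] (q : S → ℝ≥0), Measurable q →
      Q = ρ.snd.withDensity (fun u => (q u : ℝ≥0∞)) →
        (∀ᵐ ω ∂Pr, ∃ n, GPRS.Accepts ρ.snd Q q (proc ω n)) ∧
        Pr.map (fun ω => GPRS.decode (proc ω) (GPRS.index ρ.snd Q q (proc ω))) = Q ∧
        ∫⁻ ω, ENNReal.ofReal (Real.logb 2 (GPRS.index ρ.snd Q q (proc ω))) ∂Pr ≤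
          GPRS.klBits Q ρ.snd + ENNReal.ofReal (2 * Real.logb 2 (Real.exp 1))) ∧
    -- the protocol terminates and simulates the channel `y ↦ P_{x | y}`
    (∀ᵐ ω ∂Pr, ∃ n, GPRS.Accepts ρ.snd (ρ.condKernel (y ω)) (r (y ω)) (proc ω n)) ∧
    Pr.map (fun ω => (y ω, x ω)) = ρ ∧
    -- the codelength bound, which is void when the mutual information is infinite
    (GPRS.mutualInfoBits ρ ≠ ∞ →
      GPRS.condEntropyBits Pr x proc ≤
        ENNReal.ofReal ((GPRS.mutualInfoBits ρ).toReal +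
          Real.logb 2 ((GPRS.mutualInfoBits ρ).toReal + 1) + 6)) := by
  have hindex : ∀ᵐ ω ∂Pr, ρ.condKernel (y ω) = ρ.snd.withDensity fun u => (r (y ω) u : ℝ≥0∞) :=
    ae_of_ae_map hy.aemeasurable (hlaw ▸ hρ)
  have hmeas : ∀ v, Measurable (r v) := fun v => hr.comp measurable_prodMk_left
  have hjoint : Pr.map (fun ω => (y ω, proc ω)) = ρ.fst.prod (Pr.map proc) := by
    rw [(indepFun_iff_map_prod_eq_prod_map_map hy.aemeasurable
      hproc.measurable.aemeasurable).1 hind, hlaw]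
  have hpair : Measurable fun ω => (y ω, proc ω) := hy.prodMk hproc.measurable
  have hG := GPRS.measurable_accepted (P := ρ.snd) hr
  -- The index is defined through `condKernel`, which has density `r` only for almost every input.
  -- Off a null set the output is thus a jointly measurable function of input and arrivals.
  have hx_ae : ∀ᵐ ω ∂Pr, x ω = GPRS.accepted ρ.snd r (y ω, proc ω) := by
    filter_upwards [hindex] with ω hω
    rw [hx, hN, GPRS.index_eq (hmeas _) hω]
    rfl
  have := Measure.isProbabilityMeasure_map (μ := Pr) hproc.measurable.aemeasurable
  refine ⟨fun Q _ q hq hQ => hproc.gprs hq Q hQ, ?_, ?_, fun hI => ?_⟩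
  · have h := GPRS.ae_ae_exists_mem hr hρ hproc
    rw [← hjoint] at h
    filter_upwards [hindex, ae_of_ae_map hpair.aemeasurable h] with ω hω ⟨n, hn⟩
    exact ⟨n, (GPRS.accepts_iff (hmeas _) hω _).2 hn⟩
  · have hm : Measurable fun q : Y × (ℕ → ℝ × S) => (q.1, GPRS.accepted ρ.snd r q) :=
      measurable_fst.prodMk hG
    have h : (fun ω => (y ω, x ω)) =ᵐ[Pr]
        (fun q : Y × (ℕ → ℝ × S) => (q.1, GPRS.accepted ρ.snd r q)) ∘ fun ω => (y ω, proc ω) := by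
      filter_upwards [hx_ae] with ω hω
      simp [hω]
    rw [Measure.map_congr h, ← Measure.map_map hm hpair, hjoint]
    exact GPRS.map_accepted_eq hr hρ hproc
  · have hm : Measurable fun q : Y × (ℕ → ℝ × S) => (q.2, GPRS.accepted ρ.snd r q) :=
      measurable_snd.prodMk hG
    have h : (fun ω => (proc ω, x ω)) =ᵐ[Pr]
        (fun q : Y × (ℕ → ℝ × S) => (q.2, GPRS.accepted ρ.snd r q)) ∘ fun ω => (y ω, proc ω) := by
      filter_upwards [hx_ae] with ω hω
      simp [hω]
    have hxm : AEMeasurable x Pr := ⟨_, hG.comp hpair, hx_ae⟩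
    -- Regular conditional laws are almost everywhere unique, so the explicit kernel may replace
    -- `condDistrib` in the entropy.
    have hcond := condDistrib_ae_eq_of_measure_eq_compProd proc hxm
      (κ := GPRS.outputKernel ρ.snd ρ.fst r hr) (by
        rw [Measure.map_congr h, ← Measure.map_map hm hpair, hjoint]
        exact GPRS.map_accepted_eq_compProd ρ.fst hr _)
    rw [GPRS.condEntropyBits, lintegral_congr_ae (hcond.mono fun p hp => by rw [hp])]
    exact GPRS.lintegral_entropyBits_outputKernel_le hr hρ hproc hI
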